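/- Let $\mathbf k$ be a field of characteristic zero and let $A$ be an associative (not necessarily unital) $\mathbf k$-algebra with underlying (ungraded) vector space $V$ and multiplication $\mu:V\otimes V\to V$. For $n\ge 0$ let $C^{n+1}(A,A)=\mathrm{Lin}(V^{\otimes(n+1)},V)$, placed in degree $n$, and let $C^{*+1}(A,A)=\bigoplus_{n\ge0}C^{n+1}(A,A)$. Its differential is $$\delta f(a_0,\dots,a_{n+1})=(-1)^{n+2}a_0f(a_1,\dots,a_{n+1})+f(a_0,\dots,a_n)a_{n+1}+\sum_{i=0}^{n}(-1)^{i+n+1}f(a_0,\dots,a_ia_{i+1},\dots,a_{n+1})$$ for $f\in C^{n+1}(A,A)$, and its Gerstenhaber bracket is $[f,g]=f\circ g-(-1)^{mn}g\circ f$, where for $f\in C^{m+1}(A,A)$ and $g\in C^{n+1}(A,A)$ $$f\circ g=\sum_{i=1}^{m+1}(-1)^{n(i+1)}f\circ_i g,\qquad f\circ_i g=f\big(\mathrm{id}^{\otimes(i-1)}\otimes g\otimes\mathrm{id}^{\otimes(m-i+1)}\big).$$ Let $\downarrow V$ be $V$ placed in degree $-1$, with $\downarrow:V\to\downarrow V$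 the identification map, and let ${}^cT(\downarrow V)=\bigoplus_{s\ge1}(\downarrow V)^{\otimes s}$ be the (non-counital) tensor coalgebra, with $(\downarrow V)^{\otimes s}$ in degree $-s$ and $$\Delta(w_1\otimes\dots\otimes w_n)=\sum_{i=1}^{n-1}(w_1\otimes\dots\otimes w_i)\otimes(w_{i+1}\otimes\dots\otimes w_n).$$ For $d\in\mathbb Z$, $\mathrm{CoDer}^d({}^cT(\downarrow V))$ is the space of linear maps $\theta$ of degree $d$ with $\Delta\theta(c)=\sum\theta(c_{(1)})\otimes c_{(2)}+\sum(-1)^{d|c_{(1)}|}c_{(1)}\otimes\theta(c_{(2)})$, and $\mathrm{CoDer}^*=\bigoplus_{d\in\mathbb Z}\mathrm{CoDer}^d$ carries the bracket $[\theta,\phi]=\theta\phi-(-1)^{|\theta||\phi|}\phi\theta$. The $s$-th corestriction of $\theta$ is the composition $(\downarrow V)^{\otimes s}\hookrightarrow{}^cT(\downarrow V)\xrightarrow{\theta}{}^cT(\downarrow V)\to\downarrow V$. Theorem. There is a unique $\chi\in\mathrm{CoDer}^1({}^cT(\downarrow V))$ with $\chi^2=0$ whose $s$-th corestriction vanishes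 for $s\ne2$ and whose second corestriction sends $\downarrow a\otimes\downarrow b$ to $\downarrow\mu(a,b)$. Both $(C^{*+1}(A,A),[-,-],\delta)$ and $(\mathrm{CoDer}^*({}^cT(\downarrow V)),[-,-],[\chi,-])$ are dg-Lie algebras, and there is an isomorphism of dg-Lie algebras $$\xi_A:\big(C^{*+1}(A,A),[-,-],\delta\big)\xrightarrow{\ \cong\ }\big(\mathrm{CoDer}^*({}^cT(\downarrow V)),[-,-],[\chi,-]\big).$$ It sends $\phi\in C^{n+1}(A,A)$ to a coderivation of degree $n$ whose $(n+1)$-st corestriction sends $\downarrow a_1\otimes\dots\otimes\downarrow a_{n+1}$ to $\downarrow\phi(a_1,\dots,a_{n+1})$ and whose other corestrictions vanish. It is natural in $A$: if $h:A\to B$ is an algebra homomorphism and $\phi\in C^{n+1}(A,A)$, $\psi\in C^{n+1}(B,B)$ satisfy $h\circ\phi=\psi\circ h^{\otimes(n+1)}$, then $T(\downarrow h)\circ\xi_A(\phi)=\xi_B(\psi)\circ T(\downarrow h)$; in particular $\xi$ commutes with the maps induced by algebra isomorphisms. -/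

import Mathlib

open scoped TensorProduct DirectSum

universe u v

noncomputable section

/-! ### Graded vector spaces presented as direct sums -/

/-- The `ℤ`-grading of a direct sum `⨁ n, M n` in which the summand `M n` has degree `deg n`:
an element is homogeneous of degree `i` if all its components of degree other than `i` vanish. -/
def sumGrading (k : Type u) [Field k] {ι : Type} (M : ι → Type v)
    [∀ n, AddCommGroup (M n)] [∀ n, Module k (M n)] (deg : ι → ℤ) (i : ℤ) :
    Submodule k (⨁ n, M n) where
  carrier := {x | ∀ n, x n ≠ 0 → deg n = i}
  add_mem' := by
    intro x y hx hy n hn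
    by_contra h
    have h1 : x n = 0 := by
      by_contra h1
      exact h (hx n h1)
    have h2 : y n = 0 := by
      by_contra h2
      exact h (hy n h2)
    exact hn (by rw [DirectSum.add_apply, h1, h2, add_zero])
  zero_mem' := by
    intro n hn
    exact absurd rfl hn
  smul_mem' := by
    intro c x hx n hn
    refine hx n fun h => hn ?_
    rw [DirectSum.smul_apply, h, smul_zero]

section sumGrading

variable (k : Type u) [Field k] {ι : Type} [DecidableEq ι] (M : ι → Type v)
  [∀ n, AddCommGroup (M n)] [∀ n, Module k (M n)] (deg : ι → ℤ)

theorem lof_mem_sumGrading (n : ι) (x : M n) :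
    DirectSum.lof k ι M n x ∈ sumGrading k M deg (deg n) := by
  intro m hm
  by_cases h : n = m
  · rw [h]
  · exact absurd (DFinsupp.single_eq_of_ne (Ne.symm h)) hm

/-- A direct sum is the direct sum of its homogeneous components. -/
instance sumGradingDecomposition : DirectSum.Decomposition (sumGrading k M deg) :=
  DirectSum.Decomposition.ofLinearMap (sumGrading k M deg)
    (DirectSum.toModule k ι _ fun n =>
      (DirectSum.lof k ℤ (fun i => sumGrading k M deg i) (deg n)).comp
        ((DirectSum.lof k ι M n).codRestrict (sumGrading k M deg (deg n))
          (lof_mem_sumGrading k M deg n)))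
    (by
      ext n x : 2
      simp)
    (by
      ext i x : 2
      obtain ⟨x, hx⟩ := x
      classical
      have hlof : ∀ n, ∃ z : sumGrading k M deg i, (z : ⨁ n, M n) = DirectSum.lof k ι M n (x n) ∧
          DirectSum.lof k ℤ (fun i => sumGrading k M deg i) (deg n)
              ⟨DirectSum.lof k ι M n (x n), lof_mem_sumGrading k M deg n _⟩
            = DirectSum.lof k ℤ (fun i => sumGrading k M deg i) i z := by
        intro n
        by_cases h : x n = 0
        · refine ⟨0, by simp [h], ?_⟩
          rw [map_zero]
          exact (congrArg _ (Subtype.ext (by simp [h]))).trans (map_zero _)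
        · obtain rfl := hx n h
          exact ⟨⟨_, lof_mem_sumGrading k M deg n (x n)⟩, rfl, rfl⟩
      choose z hz hz' using hlof
      have hx' : x = ∑ n ∈ DFinsupp.support x, DirectSum.lof k ι M n (x n) :=
        (DirectSum.sum_support_of x).symm
      have hsum : (⟨x, hx⟩ : sumGrading k M deg i) = ∑ n ∈ DFinsupp.support x, z n := by
        apply Subtype.ext
        rw [AddSubmonoidClass.coe_finsetSum]
        simp only [hz]
        exact hx'
      simp only [LinearMap.comp_apply, DirectSum.coeLinearMap_lof, LinearMap.id_apply]
      rw [hsum, map_sum]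
      conv_lhs => rw [hx', map_sum]
      refine Finset.sum_congr rfl fun n _ => ?_
      rw [DirectSum.toModule_lof, ← hz']
      rfl)

end sumGrading

/-- The bilinear extension to `⨁ n, M n` of bilinear maps `M m × M n → M (m + n)`. -/
def sumBilin (k : Type u) [Field k] {ι : Type} [DecidableEq ι] [Add ι] (M : ι → Type v)
    [∀ n, AddCommGroup (M n)] [∀ n, Module k (M n)]
    (B : ∀ m n, M m →ₗ[k] M n →ₗ[k] M (m + n)) :
    (⨁ n, M n) →ₗ[k] (⨁ n, M n) →ₗ[k] (⨁ n, M n) :=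
  DirectSum.toModule k ι _ fun m =>
    (DirectSum.toModule k ι _ fun n =>
      ((B m n).compr₂ (DirectSum.lof k ι M (m + n))).flip).flip

theorem sumBilin_lof (k : Type u) [Field k] {ι : Type} [DecidableEq ι] [Add ι] (M : ι → Type v)
    [∀ n, AddCommGroup (M n)] [∀ n, Module k (M n)]
    (B : ∀ m n, M m →ₗ[k] M n →ₗ[k] M (m + n)) (m n : ι) (x : M m) (y : M n) :
    sumBilin k M B (DirectSum.lof k ι M m x) (DirectSum.lof k ι M n y)
      = DirectSum.lof k ι M (m + n) (B m n x y) := by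
  simp [sumBilin]

/-! ### Differential graded Lie algebras -/

/-- The `ℤ`-graded vector space `(L, 𝓛)` is a dg-Lie algebra for the bilinear map `br` and the
linear map `d`. -/
structure IsDGLie {k : Type u} [Field k] {L : Type v} [AddCommGroup L] [Module k L]
    (𝓛 : ℤ → Submodule k L) (br : L →ₗ[k] L →ₗ[k] L) (d : L →ₗ[k] L) : Prop where
  internal : DirectSum.IsInternal 𝓛
  br_mem : ∀ i j : ℤ, ∀ a ∈ 𝓛 i, ∀ b ∈ 𝓛 j, br a b ∈ 𝓛 (i + j)
  antisymm : ∀ i j : ℤ, ∀ a ∈ 𝓛 i, ∀ b ∈ 𝓛 j, br a b = -((-1 : k) ^ (i * j) • br b a)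
  jacobi : ∀ p q r : ℤ, ∀ a ∈ 𝓛 p, ∀ b ∈ 𝓛 q, ∀ c ∈ 𝓛 r,
    br a (br b c) + (-1 : k) ^ (p * (q + r)) • br b (br c a)
      + (-1 : k) ^ (r * (p + q)) • br c (br a b) = 0
  d_mem : ∀ i : ℤ, ∀ a ∈ 𝓛 i, d a ∈ 𝓛 (i + 1)
  leibniz : ∀ i j : ℤ, ∀ a ∈ 𝓛 i, ∀ b ∈ 𝓛 j,
    d (br a b) = br (d a) b + (-1 : k) ^ i • br a (d b)
  d_sq : ∀ a, d (d a) = 0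

/-- A linear isomorphism `ξ` is an isomorphism of dg-Lie algebras: it matches the gradings, the
brackets and the differentials. -/
structure IsDGLieIso {k : Type u} [Field k] {L : Type v} [AddCommGroup L] [Module k L]
    {L' : Type*} [AddCommGroup L'] [Module k L']
    (𝓛 : ℤ → Submodule k L) (br : L →ₗ[k] L →ₗ[k] L) (d : L →ₗ[k] L)
    (𝓛' : ℤ → Submodule k L') (br' : L' →ₗ[k] L' →ₗ[k] L') (d' : L' →ₗ[k] L')
    (ξ : L ≃ₗ[k] L') : Prop where
  map_grading : ∀ i a, ξ a ∈ 𝓛' i ↔ a ∈ 𝓛 i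
  map_br : ∀ a b, ξ (br a b) = br' (ξ a) (ξ b)
  map_d : ∀ a, ξ (d a) = d' (ξ a)

/-! ### Coderivations of a graded coalgebra -/

section Coderivations

variable (k : Type u) [Field k] {C : Type v} [AddCommGroup C] [Module k C]
  (𝒞 : ℤ → Submodule k C) [DirectSum.Decomposition 𝒞] (Δ : C →ₗ[k] C ⊗[k] C)

/-- The linear map given by `c ↦ (-1) ^ (d * |c|) • c` on homogeneous elements `c`. -/
def koszulMap (d : ℤ) : C →ₗ[k] C :=
  (DirectSum.toModule k ℤ C fun i => (-1 : k) ^ (d * i) • (𝒞 i).subtype).comp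
    (DirectSum.decomposeLinearEquiv 𝒞).toLinearMap

theorem koszulMap_of_mem (d i : ℤ) (c : C) (hc : c ∈ 𝒞 i) :
    koszulMap k 𝒞 d c = (-1 : k) ^ (d * i) • c := by
  simp only [koszulMap, LinearMap.comp_apply, LinearEquiv.coe_coe,
    DirectSum.decomposeLinearEquiv_apply, DirectSum.decompose_of_mem 𝒞 hc]
  erw [DirectSum.toModule_lof]
  simp

variable {k} in
/-- The linear map `θ` has degree `d`. -/
def HasDegree (d : ℤ) (θ : Module.End k C) : Prop :=
  ∀ i : ℤ, ∀ c ∈ 𝒞 i, θ c ∈ 𝒞 (i + d)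

/-- The degree `d` coderivations of the graded coalgebra `(C, 𝒞, Δ)`: degree `d` linear maps
`θ : C → C` with `Δ θ(c) = ∑ θ(c₁) ⊗ c₂ + ∑ (-1) ^ (d * |c₁|) • c₁ ⊗ θ(c₂)`. -/
def CoDer (d : ℤ) : Submodule k (Module.End k C) where
  carrier := {θ | HasDegree 𝒞 d θ ∧
    Δ ∘ₗ θ = TensorProduct.map θ LinearMap.id ∘ₗ Δ
      + TensorProduct.map (koszulMap k 𝒞 d) θ ∘ₗ Δ}
  add_mem' := by
    rintro θ φ ⟨h1, h2⟩ ⟨h3, h4⟩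
    refine ⟨fun i c hc => (𝒞 _).add_mem (h1 i c hc) (h3 i c hc), ?_⟩
    rw [LinearMap.comp_add, h2, h4, TensorProduct.map_add_left, TensorProduct.map_add_right,
      LinearMap.add_comp, LinearMap.add_comp]
    abel
  zero_mem' := by
    refine ⟨fun i c hc => (𝒞 _).zero_mem, ?_⟩
    simp
  smul_mem' := by
    rintro a θ ⟨h1, h2⟩
    refine ⟨fun i c hc => (𝒞 _).smul_mem a (h1 i c hc), ?_⟩
    rw [LinearMap.comp_smul, h2, TensorProduct.map_smul_left, TensorProduct.map_smul_right,
      LinearMap.smul_comp, LinearMap.smul_comp, smul_add]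

theorem koszulMap_comp (a b : ℤ) (θ : Module.End k C) (hθ : HasDegree 𝒞 a θ) :
    koszulMap k 𝒞 b ∘ₗ θ = (-1 : k) ^ (a * b) • (θ ∘ₗ koszulMap k 𝒞 b) := by
  apply LinearMap.ext
  intro c
  induction c using DirectSum.Decomposition.inductionOn 𝒞 with
  | zero => simp
  | @homogeneous i c =>
    simp only [LinearMap.comp_apply, LinearMap.smul_apply]
    rw [koszulMap_of_mem k 𝒞 b i c c.2, koszulMap_of_mem k 𝒞 b _ _ (hθ i c c.2), map_smul,
      smul_smul, ← zpow_add₀ (by simp)]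
    congr 2
    ring
  | add x y hx hy => rw [map_add, map_add, hx, hy]

theorem koszulMap_add (a b : ℤ) :
    koszulMap k 𝒞 a ∘ₗ koszulMap k 𝒞 b = koszulMap k 𝒞 (a + b) := by
  apply LinearMap.ext
  intro c
  induction c using DirectSum.Decomposition.inductionOn 𝒞 with
  | zero => simp
  | @homogeneous i c =>
    rw [LinearMap.comp_apply, koszulMap_of_mem k 𝒞 b i c c.2, map_smul,
      koszulMap_of_mem k 𝒞 a i c c.2, koszulMap_of_mem k 𝒞 _ i c c.2, smul_smul,
      ← zpow_add₀ (by simp)]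
    congr 2
    ring
  | add x y hx hy => rw [map_add, map_add, hx, hy]

theorem commutator_mem_CoDer (a b : ℤ) (θ φ : Module.End k C)
    (hθ : θ ∈ CoDer k 𝒞 Δ a) (hφ : φ ∈ CoDer k 𝒞 Δ b) :
    θ ∘ₗ φ - (-1 : k) ^ (a * b) • (φ ∘ₗ θ) ∈ CoDer k 𝒞 Δ (a + b) := by
  have hs : (-1 : k) ^ (a * b) * (-1 : k) ^ (a * b) = 1 := by
    rw [← mul_zpow]
    simp
  have hcomp : ∀ (a b : ℤ) (θ φ : Module.End k C), θ ∈ CoDer k 𝒞 Δ a → φ ∈ CoDer k 𝒞 Δ b →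
      Δ ∘ₗ (θ ∘ₗ φ) = TensorProduct.map (θ ∘ₗ φ) LinearMap.id ∘ₗ Δ
        + TensorProduct.map (θ ∘ₗ koszulMap k 𝒞 b) φ ∘ₗ Δ
        + (-1 : k) ^ (a * b) • (TensorProduct.map (φ ∘ₗ koszulMap k 𝒞 a) θ ∘ₗ Δ)
        + TensorProduct.map (koszulMap k 𝒞 (a + b)) (θ ∘ₗ φ) ∘ₗ Δ := by
    rintro a b θ φ ⟨-, h2⟩ ⟨h3, h4⟩
    rw [← LinearMap.comp_assoc, h2, LinearMap.add_comp, LinearMap.comp_assoc,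
      LinearMap.comp_assoc, h4, LinearMap.comp_add, LinearMap.comp_add]
    simp only [← LinearMap.comp_assoc, ← TensorProduct.map_comp, LinearMap.id_comp,
      LinearMap.comp_id, koszulMap_add, koszulMap_comp k 𝒞 b a φ h3, TensorProduct.map_smul_left,
      LinearMap.smul_comp, mul_comm b a]
    abel
  have hl : ∀ f f' g : Module.End k C, TensorProduct.map (f - f') g
      = TensorProduct.map f g - TensorProduct.map f' g := fun f f' g =>
    TensorProduct.ext' fun x y => by simp [TensorProduct.sub_tmul]
  have hr : ∀ f g g' : Module.End k C, TensorProduct.map f (g - g')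
      = TensorProduct.map f g - TensorProduct.map f g' := fun f g g' =>
    TensorProduct.ext' fun x y => by simp [TensorProduct.tmul_sub]
  have h1 := hcomp a b θ φ hθ hφ
  have h2 := hcomp b a φ θ hφ hθ
  refine ⟨fun i c hc => (𝒞 _).sub_mem ?_ ((𝒞 _).smul_mem _ ?_), ?_⟩
  · have := hθ.1 _ _ (hφ.1 i c hc)
    rwa [show i + b + a = i + (a + b) by ring] at this
  · have := hφ.1 _ _ (hθ.1 i c hc)
    rwa [show i + a + b = i + (a + b) by ring] at this
  · rw [LinearMap.comp_sub, LinearMap.comp_smul, h1, h2, mul_comm b a, add_comm b a,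
      hl, hr, TensorProduct.map_smul_left,
      TensorProduct.map_smul_right, LinearMap.sub_comp, LinearMap.sub_comp,
      LinearMap.smul_comp, LinearMap.smul_comp]
    simp only [smul_add, smul_smul, hs, one_smul]
    abel

/-- The commutator `[θ, φ] = θ ∘ φ - (-1) ^ (a * b) • φ ∘ θ` of coderivations of degrees `a`
and `b`. -/
def coderBracket (a b : ℤ) :
    CoDer k 𝒞 Δ a →ₗ[k] CoDer k 𝒞 Δ b →ₗ[k] CoDer k 𝒞 Δ (a + b) :=
  LinearMap.mk₂ k
    (fun θ φ => ⟨(θ : Module.End k C) ∘ₗ φ - (-1 : k) ^ (a * b) • ((φ : Module.End k C) ∘ₗ θ),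
      commutator_mem_CoDer k 𝒞 Δ a b θ φ θ.2 φ.2⟩)
    (by
      intro θ θ' φ
      apply Subtype.ext
      simp only [Submodule.coe_add, LinearMap.add_comp, LinearMap.comp_add, smul_add]
      abel)
    (by
      intro c θ φ
      apply Subtype.ext
      simp only [Submodule.coe_smul, LinearMap.smul_comp, LinearMap.comp_smul, smul_sub,
        smul_comm c])
    (by
      intro θ φ φ'
      apply Subtype.ext
      simp only [Submodule.coe_add, LinearMap.add_comp, LinearMap.comp_add, smul_add]
      abel)
    (by
      intro c θ φ
      apply Subtype.ext
      simp only [Submodule.coe_smul, LinearMap.smul_comp, LinearMap.comp_smul, smul_sub,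
        smul_comm c])

/-- `CoDer^*(C) = ⨁ d, CoDer^d(C)`. -/
abbrev CoDerSum : Type v := ⨁ d : ℤ, CoDer k 𝒞 Δ d

/-- The grading of `CoDer^*(C)`. -/
abbrev coderGrading : ℤ → Submodule k (CoDerSum k 𝒞 Δ) :=
  sumGrading k (fun d => CoDer k 𝒞 Δ d) (fun d => d)

/-- The commutator bracket of `CoDer^*(C)`. -/
def coderSumBracket :
    CoDerSum k 𝒞 Δ →ₗ[k] CoDerSum k 𝒞 Δ →ₗ[k] CoDerSum k 𝒞 Δ :=
  sumBilin k (fun d => CoDer k 𝒞 Δ d) (coderBracket k 𝒞 Δ)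

/-- The map `[χ, -]` for `χ` a coderivation of degree `1`. -/
def coderDifferential (χ : CoDer k 𝒞 Δ 1) : CoDerSum k 𝒞 Δ →ₗ[k] CoDerSum k 𝒞 Δ :=
  coderSumBracket k 𝒞 Δ (DirectSum.lof k ℤ (fun d => CoDer k 𝒞 Δ d) 1 χ)

end Coderivations

/-! ### The tensor coalgebra of the desuspension -/

/-- The desuspension `↓V` of an ungraded vector space `V`: a copy of `V` placed in degree `-1`. -/
def Desusp (V : Type v) : Type v := V

instance (V : Type v) [AddCommGroup V] : AddCommGroup (Desusp V) :=
  inferInstanceAs (AddCommGroup V)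

instance (k : Type u) (V : Type v) [Field k] [AddCommGroup V] [Module k V] :
    Module k (Desusp V) :=
  inferInstanceAs (Module k V)

/-- The desuspension map `↓ : V → ↓V`. -/
def down (k : Type u) {V : Type v} [Field k] [AddCommGroup V] [Module k V] : V ≃ₗ[k] Desusp V :=
  LinearEquiv.refl k V

section TensorCoalgebra

variable (k : Type u) [Field k] (W : Type v) [AddCommGroup W] [Module k W]

/-- The underlying vector space of the (non-unital) tensor algebra, `T(W) = ⨁ W^{⊗ s}` over
`s ≥ 1`. The summand with index `n` is `W^{⊗ (n + 1)}`. -/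
abbrev TensorSum : Type (max u v) := ⨁ n : ℕ, ⨂[k]^(n + 1) W

/-- The inclusion of `W^{⊗ (n + 1)}` into `T(W)`. -/
def tensorIncl (n : ℕ) : ⨂[k]^(n + 1) W →ₗ[k] TensorSum k W :=
  DirectSum.lof k ℕ (fun n => ⨂[k]^(n + 1) W) n

/-- The projection `T(W) → W`. -/
def tensorProj : TensorSum k W →ₗ[k] W :=
  (PiTensorProduct.subsingletonEquiv (R := k) (s := fun _ : Fin 1 => W) 0).toLinearMap ∘ₗ
    DirectSum.component k ℕ (fun n => ⨂[k]^(n + 1) W) 0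

/-- Words with `n + 1` letters consist of a first part with `i + 1` and a second part with
`n - i` letters. -/
def splitEquiv (n : ℕ) (i : Fin n) : Fin (i + 1) ⊕ Fin (n - 1 - i + 1) ≃ Fin (n + 1) :=
  finSumFinEquiv.trans (finCongr (by have := i.2; omega))

/-- The deconcatenation
`w₁ ⊗ … ⊗ wₙ₊₁ ↦ (w₁ ⊗ … ⊗ wᵢ₊₁) ⊗ (wᵢ₊₂ ⊗ … ⊗ wₙ₊₁)`. -/
def deconcat (n : ℕ) (i : Fin n) :
    ⨂[k]^(n + 1) W →ₗ[k] (⨂[k]^(i + 1) W) ⊗[k] (⨂[k]^(n - 1 - i + 1) W) :=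
  (PiTensorProduct.tmulEquiv k W).symm.toLinearMap ∘ₗ
    (PiTensorProduct.reindex k (fun _ => W) (splitEquiv n i).symm).toLinearMap

/-- The comultiplication of the tensor coalgebra: the sum of all deconcatenations of a word into
two non-empty words. -/
def tensorComul : TensorSum k W →ₗ[k] TensorSum k W ⊗[k] TensorSum k W :=
  DirectSum.toModule k ℕ _ fun n => ∑ i : Fin n,
    TensorProduct.map (tensorIncl k W i) (tensorIncl k W (n - 1 - i)) ∘ₗ deconcat k W n i

theorem tensorComul_tprod (n : ℕ) (w : Fin (n + 1) → W) :
    tensorComul k W (tensorIncl k W n (PiTensorProduct.tprod k w)) = ∑ i : Fin n,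
      tensorIncl k W i (PiTensorProduct.tprod k fun j => w ⟨j, by omega⟩) ⊗ₜ[k]
        tensorIncl k W (n - 1 - i)
          (PiTensorProduct.tprod k fun j => w ⟨i + 1 + j, by omega⟩) := by
  rw [tensorComul, tensorIncl, DirectSum.toModule_lof, LinearMap.sum_apply]
  refine Finset.sum_congr rfl fun i _ => ?_
  simp only [deconcat, LinearMap.comp_apply, LinearEquiv.coe_coe]
  erw [PiTensorProduct.reindex_tprod]
  rw [PiTensorProduct.tmulEquiv_symm_apply, TensorProduct.map_tmul]
  rfl

variable {W} in
/-- The map `T(W) → T(W')` induced by a linear map `W → W'`. -/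
def tensorMap {W' : Type v} [AddCommGroup W'] [Module k W'] (h : W →ₗ[k] W') :
    TensorSum k W →ₗ[k] TensorSum k W' :=
  DirectSum.lmap fun n => PiTensorProduct.map (s := fun _ : Fin (n + 1) => W)
    (t := fun _ => W') fun _ => h

/-- The corestriction `W^{⊗ (n + 1)} → T(W) → T(W) → W` of a linear map `θ : T(W) → T(W)`. -/
def corestriction (θ : Module.End k (TensorSum k W)) (n : ℕ) : ⨂[k]^(n + 1) W →ₗ[k] W :=
  tensorProj k W ∘ₗ θ ∘ₗ tensorIncl k W n

end TensorCoalgebra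

section

variable (k : Type u) [Field k] (V : Type v) [AddCommGroup V] [Module k V]

/-- The grading of `T(↓V)` induced by that of `↓V`: since `↓V` is concentrated in degree `-1`,
the summand `(↓V)^{⊗ (n + 1)}` is concentrated in degree `-(n + 1)`. -/
abbrev tensorGrading : ℤ → Submodule k (TensorSum k (Desusp V)) :=
  sumGrading k (fun n : ℕ => ⨂[k]^(n + 1) (Desusp V)) (fun n => -((n : ℤ) + 1))

/-- `CoDer^d` of the tensor coalgebra of `↓V`. -/
abbrev TCoDer (d : ℤ) : Submodule k (Module.End k (TensorSum k (Desusp V))) :=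
  CoDer k (tensorGrading k V) (tensorComul k (Desusp V)) d

/-- `CoDer^*` of the tensor coalgebra of `↓V`. -/
abbrev TCoDerSum : Type (max u v) :=
  CoDerSum k (tensorGrading k V) (tensorComul k (Desusp V))

/-- The grading of `CoDer^*` of the tensor coalgebra of `↓V`. -/
abbrev tCoDerGrading : ℤ → Submodule k (TCoDerSum k V) :=
  coderGrading k (tensorGrading k V) (tensorComul k (Desusp V))

/-- The commutator bracket on `CoDer^*` of the tensor coalgebra of `↓V`. -/
abbrev tCoDerBracket : TCoDerSum k V →ₗ[k] TCoDerSum k V →ₗ[k] TCoDerSum k V :=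
  coderSumBracket k (tensorGrading k V) (tensorComul k (Desusp V))

variable {V} in
/-- The map `[χ, -]` on `CoDer^*` of the tensor coalgebra of `↓V`. -/
abbrev tCoDerDifferential (χ : TCoDer k V 1) : TCoDerSum k V →ₗ[k] TCoDerSum k V :=
  coderDifferential k (tensorGrading k V) (tensorComul k (Desusp V)) χ

/-- A quadratic differential on the tensor coalgebra of `↓V`: a coderivation `χ` of degree `1`
with `χ ∘ χ = 0` whose corestriction to `(↓V)^{⊗ s}` vanishes for `s ≠ 2`. -/
def IsQuadraticDifferential (χ : TCoDer k V 1) : Prop :=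
  (χ : Module.End k (TensorSum k (Desusp V))) ∘ₗ (χ : Module.End k _) = 0 ∧
    ∀ n : ℕ, n + 1 ≠ 2 → corestriction k (Desusp V) χ n = 0

end

/-! ### The Hochschild complex -/

section Hochschild

/-- The word `v₀, …, vᵢ₋₁, g(vᵢ, …, vᵢ₊ₙ), vᵢ₊ₙ₊₁, …, vₘ₊ₙ` with `m + 1` letters. -/
def insertWord {V : Type v} {m n : ℕ} (i : Fin (m + 1)) (g : (Fin (n + 1) → V) → V)
    (v : Fin (m + n + 1) → V) (j : Fin (m + 1)) : V :=
  if (j : ℕ) < i then v ⟨j, by omega⟩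
  else if (j : ℕ) = i then g fun l => v ⟨i + l, by omega⟩
  else v ⟨j + n, by omega⟩

theorem insertWord_eq_update {V : Type v} {m n : ℕ} (i : Fin (m + 1)) (g g' : (Fin (n + 1) → V) → V)
    (v : Fin (m + n + 1) → V) :
    insertWord i g v = Function.update (insertWord i g' v) i (g fun l => v ⟨i + l, by omega⟩) := by
  funext j
  by_cases h : j = i
  · subst h
    simp [insertWord]
  · have h' : (j : ℕ) ≠ i := fun e => h (Fin.ext e)
    simp [insertWord, h, h']

theorem insertWord_update {V : Type v} {m n : ℕ} (i : Fin (m + 1)) (g : (Fin (n + 1) → V) → V)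
    (v : Fin (m + n + 1) → V) (a : Fin (m + n + 1)) (x : V) :
    insertWord i g (Function.update v a x) =
      if h : (a : ℕ) < i then Function.update (insertWord i g v) ⟨a, by omega⟩ x
      else if h' : (a : ℕ) ≤ i + n then Function.update (insertWord i g v) i
        (g (Function.update (fun l => v ⟨i + l, by omega⟩) ⟨a - i, by omega⟩ x))
      else Function.update (insertWord i g v) ⟨a - n, by omega⟩ x := by
  have hsub : (fun l : Fin (n + 1) => Function.update v a x ⟨i + l, by omega⟩)
      = if h : (i : ℕ) ≤ a ∧ (a : ℕ) ≤ i + n then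
          Function.update (fun l : Fin (n + 1) => v ⟨i + l, by omega⟩) ⟨a - i, by omega⟩ x
        else fun l : Fin (n + 1) => v ⟨i + l, by omega⟩ := by
    funext l
    split_ifs with h
    · simp only [Function.update_apply, Fin.ext_iff]
      have : ((i : ℕ) + l = a) ↔ ((l : ℕ) = a - i) := by omega
      simp [this]
    · have : ¬ ((i : ℕ) + l = a) := by omega
      simp [Fin.ext_iff, this]
  funext j
  unfold insertWord
  rw [hsub]
  split_ifs <;> simp only [Function.update_apply, Fin.ext_iff] <;> split_ifs <;>
    first
      | rfl
      | omega

theorem contractNth_update {A : Type v} [Mul A] {n : ℕ} (i : Fin (n + 1)) (v : Fin (n + 2) → A)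
    (a : Fin (n + 2)) (x : A) :
    i.castSucc.contractNth (· * ·) (Function.update v a x) =
      if h : (a : ℕ) < i then
        Function.update (i.castSucc.contractNth (· * ·) v) ⟨a, by omega⟩ x
      else if (a : ℕ) = i then
        Function.update (i.castSucc.contractNth (· * ·) v) i (x * v i.succ)
      else if (a : ℕ) = i + 1 then
        Function.update (i.castSucc.contractNth (· * ·) v) i (v i.castSucc * x)
      else
        Function.update (i.castSucc.contractNth (· * ·) v) ⟨a - 1, by omega⟩ x := by
  funext j
  unfold Fin.contractNth
  simp only [Fin.val_castSucc]
  split_ifs <;> simp only [Function.update_apply, Fin.ext_iff, Fin.val_castSucc, Fin.val_succ] <;>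
    split_ifs <;>
    first
      | rfl
      | omega
      | (congr 2; apply Fin.ext; simp; omega)

section Circ

variable (k : Type u) [Field k] (V : Type v) [AddCommGroup V] [Module k V]

/-- `C^{n+1}(V, V) = Lin(V^{⊗ (n + 1)}, V)`, the `(n + 1)`-multilinear maps. -/
abbrev Cochain (n : ℕ) : Type v := MultilinearMap k (fun _ : Fin (n + 1) => V) V

variable {V} in
/-- `(f ∘ᵢ g)(v₀, …, vₘ₊ₙ) = f(v₀, …, vᵢ₋₁, g(vᵢ, …, vᵢ₊ₙ), vᵢ₊ₙ₊₁, …, vₘ₊ₙ)`. The argument `i`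
counts from `0`. -/
def circAt {m n : ℕ} (i : Fin (m + 1)) (f : Cochain k V m) (g : Cochain k V n) :
    Cochain k V (m + n) :=
  MultilinearMap.mk' (fun v => f (insertWord i g v))
    (by
      intro v a x y
      simp only [insertWord_update]
      split_ifs <;> simp only [MultilinearMap.map_update_add])
    (by
      intro v a c x
      simp only [insertWord_update]
      split_ifs <;> simp only [MultilinearMap.map_update_smul])

/-- `f ∘ g = ∑_{i=1}^{m+1} (-1) ^ (n * (i + 1)) f ∘ᵢ g`, as a bilinear map. -/
def circ (m n : ℕ) : Cochain k V m →ₗ[k] Cochain k V n →ₗ[k] Cochain k V (m + n) :=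
  ∑ i : Fin (m + 1), (-1 : k) ^ (n * ((i + 1) + 1)) •
    LinearMap.mk₂ k (fun f g => circAt k i f g)
      (fun f f' g => by ext v; rfl)
      (fun c f g => by ext v; rfl)
      (fun f g g' => by
        ext v
        change f _ = f _ + f _
        rw [insertWord_eq_update i _ 0, insertWord_eq_update i g 0, insertWord_eq_update i g' 0,
          add_apply, MultilinearMap.map_update_add])
      (fun c f g => by
        ext v
        change f _ = c • f _
        rw [insertWord_eq_update i _ 0, insertWord_eq_update i g 0,
          smul_apply, MultilinearMap.map_update_smul])

variable {V} in
/-- A cochain in `C^{n+m+1}` regarded as an element of `C^{m+n+1}`. -/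
def castCochain (m n : ℕ) : Cochain k V (n + m) ≃ₗ[k] Cochain k V (m + n) :=
  MultilinearMap.domDomCongrLinearEquiv k k V V (finCongr (by omega))

/-- The Gerstenhaber bracket `[f, g] = f ∘ g - (-1) ^ (m * n) g ∘ f`. -/
def gerstenhaber (m n : ℕ) : Cochain k V m →ₗ[k] Cochain k V n →ₗ[k] Cochain k V (m + n) :=
  circ k V m n
    - (-1 : k) ^ (m * n) • ((circ k V n m).compr₂ (castCochain k m n).toLinearMap).flip

/-- The space `C^{*+1}(V, V) = ⨁ C^{n+1}(V, V)` over `n ≥ 0`. -/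
abbrev CochainSum : Type v := ⨁ n : ℕ, Cochain k V n

/-- The grading of `C^{*+1}(V, V)`: the summand `C^{n+1}` has degree `n`. -/
abbrev cochainGrading : ℤ → Submodule k (CochainSum k V) :=
  sumGrading k (fun n => Cochain k V n) (fun n : ℕ => (n : ℤ))

/-- The Gerstenhaber bracket on `C^{*+1}(V, V)`. -/
def gerstenhaberSum : CochainSum k V →ₗ[k] CochainSum k V →ₗ[k] CochainSum k V :=
  sumBilin k (fun n => Cochain k V n) (gerstenhaber k V)

end Circ

section Differential

variable (k : Type u) [Field k] (A : Type v) [NonUnitalRing A] [Module k A]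
  [IsScalarTower k A A] [SMulCommClass k A A]

variable {A}

/-- `(a₀, …, aₙ₊₁) ↦ a₀ f(a₁, …, aₙ₊₁)`. -/
def leftMulCochain {n : ℕ} (f : Cochain k A n) : Cochain k A (n + 1) :=
  MultilinearMap.mk' (fun a => a 0 * f (Fin.tail a))
    (by
      intro v i x y
      cases i using Fin.cases with
      | zero => simp [Fin.tail_update_zero, add_mul]
      | succ i => simp [Fin.tail_update_succ, mul_add, (Fin.succ_ne_zero i).symm])
    (by
      intro v i c x
      cases i using Fin.cases with
      | zero => simp [Fin.tail_update_zero, smul_mul_assoc]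
      | succ i => simp [Fin.tail_update_succ, mul_smul_comm, (Fin.succ_ne_zero i).symm])

/-- `(a₀, …, aₙ₊₁) ↦ f(a₀, …, aₙ) aₙ₊₁`. -/
def rightMulCochain {n : ℕ} (f : Cochain k A n) : Cochain k A (n + 1) :=
  MultilinearMap.mk' (fun a => f (Fin.init a) * a (Fin.last (n + 1)))
    (by
      intro v i x y
      cases i using Fin.lastCases with
      | last => simp [Fin.init_update_last, mul_add]
      | cast i => simp [Fin.init_update_castSucc, add_mul, (Fin.castSucc_lt_last i).ne'])
    (by
      intro v i c x
      cases i using Fin.lastCases with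
      | last => simp [Fin.init_update_last, mul_smul_comm]
      | cast i => simp [Fin.init_update_castSucc, smul_mul_assoc, (Fin.castSucc_lt_last i).ne'])

/-- `(a₀, …, aₙ₊₁) ↦ f(a₀, …, aᵢ aᵢ₊₁, …, aₙ₊₁)`. -/
def contractCochain {n : ℕ} (i : Fin (n + 1)) (f : Cochain k A n) : Cochain k A (n + 1) :=
  MultilinearMap.mk' (fun a => f (i.castSucc.contractNth (· * ·) a))
    (by
      intro v a x y
      simp only [contractNth_update]
      split_ifs <;> simp only [add_mul, mul_add, MultilinearMap.map_update_add])
    (by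
      intro v a c x
      simp only [contractNth_update]
      split_ifs <;>
        simp only [smul_mul_assoc, mul_smul_comm, MultilinearMap.map_update_smul])

variable (A)

/-- The Hochschild differential `C^{n+1}(A, A) → C^{n+2}(A, A)`; see `hochschild_apply`. -/
def hochschild (n : ℕ) : Cochain k A n →ₗ[k] Cochain k A (n + 1) where
  toFun f := (-1 : k) ^ (n + 2) • leftMulCochain k f + rightMulCochain k f
    + ∑ i : Fin (n + 1), (-1 : k) ^ ((i : ℕ) + (n + 1)) • contractCochain k i f
  map_add' f g := by
    have h1 : leftMulCochain k (f + g) = leftMulCochain k f + leftMulCochain k g := by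
      ext a
      exact mul_add _ _ _
    have h2 : rightMulCochain k (f + g) = rightMulCochain k f + rightMulCochain k g := by
      ext a
      exact add_mul _ _ _
    have h3 : ∀ i, contractCochain k i (f + g)
        = contractCochain k i f + contractCochain k i g := fun i => rfl
    simp only [h1, h2, h3, smul_add, Finset.sum_add_distrib]
    abel
  map_smul' c f := by
    have h1 : leftMulCochain k (c • f) = c • leftMulCochain k f := by
      ext a
      exact mul_smul_comm _ _ _
    have h2 : rightMulCochain k (c • f) = c • rightMulCochain k f := by
      ext a
      exact smul_mul_assoc _ _ _
    have h3 : ∀ i, contractCochain k i (c • f) = c • contractCochain k i f := fun i => rfl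
    simp only [h1, h2, h3, smul_add, Finset.smul_sum, smul_comm _ c, RingHom.id_apply]

theorem hochschild_apply (n : ℕ) (f : Cochain k A n) (a : Fin (n + 2) → A) :
    hochschild k A n f a =
      (-1 : k) ^ (n + 2) • (a 0 * f fun j => a j.succ)
        + (f fun j => a j.castSucc) * a (Fin.last (n + 1))
        + ∑ i : Fin (n + 1), (-1 : k) ^ ((i : ℕ) + (n + 1)) •
            f (i.castSucc.contractNth (· * ·) a) := by
  change ((-1 : k) ^ (n + 2) • leftMulCochain k f + rightMulCochain k f
    + ∑ i : Fin (n + 1), (-1 : k) ^ ((i : ℕ) + (n + 1)) • contractCochain k i f) a = _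
  rw [add_apply, add_apply, sum_apply]
  rfl

/-- The Hochschild differential of `C^{*+1}(A, A)`. -/
def hochschildSum : CochainSum k A →ₗ[k] CochainSum k A :=
  DirectSum.toModule k ℕ _ fun n =>
    DirectSum.lof k ℕ (fun n => Cochain k A n) (n + 1) ∘ₗ hochschild k A n

end Differential
end Hochschild

/-! ### The correspondence between multiplications, cochains and coderivations -/

section Correspondence

variable (k : Type u) [Field k] (A : Type v) [NonUnitalRing A] [Module k A]

/-- The coderivation `χ` corresponds to the multiplication `μ` of `A`: the corestriction
`f : ↓A ⊗ ↓A → ↓A` of `χ` satisfies `f ∘ (↓ ⊗ ↓) = ↓ ∘ μ`. Elements of `A` have degree `0`, so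
`(↓ ⊗ ↓)(a ⊗ b) = ↓a ⊗ ↓b`. -/
def CorrespondsToMul (χ : TCoDer k A 1) : Prop :=
  ∀ a b : A, corestriction k (Desusp A) χ 1 (PiTensorProduct.tprod k ![down k a, down k b])
    = down k (a * b)

variable {A} in
/-- The coderivation `θ` has `(n + 1)`st corestriction `f` with `f ∘ ↓^{⊗ (n + 1)} = ↓ ∘ φ`, and
its other corestrictions vanish. -/
def IsCoderivationOf {n : ℕ} (φ : Cochain k A n) (θ : TCoDer k A n) : Prop :=
  (∀ a : Fin (n + 1) → A,
    corestriction k (Desusp A) θ n (PiTensorProduct.tprod k fun i => down k (a i))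
      = down k (φ a)) ∧
  ∀ s : ℕ, s ≠ n → corestriction k (Desusp A) θ s = 0

variable {A} in
/-- The map `T(↓A) → T(↓B)` induced by an algebra homomorphism `h : A → B`. -/
def tensorMapDesusp {B : Type v} [NonUnitalRing B] [Module k B] (h : A →ₙₐ[k] B) :
    TensorSum k (Desusp A) →ₗ[k] TensorSum k (Desusp B) :=
  tensorMap k ((down k).toLinearMap ∘ₗ (h : A →ₗ[k] B) ∘ₗ (down k).symm.toLinearMap)

end Correspondence

end

noncomputable section

/-! ### Words in the tensor coalgebra -/

section Words

variable (k : Type u) [Field k] {V : Type v} [AddCommGroup V] [Module k V]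

/-! The tensor coalgebra is cofree enough that a coderivation is determined by its corestrictions.
Its primitive elements lie in `↓V`, because every deconcatenation of words of a fixed length is
injective. The coderivation rule expresses `Δθ(w)` through the values of `θ` on proper subwords of
`w`, so by induction on length two coderivations of the same degree with equal corestrictions agree
(`coder_ext`). Since `↓V` sits in degree `-1`, a coderivation of degree `n` has only an `(n + 1)`st
corestriction, and none at all if `n < 0`.

Conversely, a cochain `φ` of degree `n` extends to the signed sum of its insertions into a word,
with Koszul sign `(-1)^(n i)` for passing `i` letters (`cochainCoder`, `cochainCoder_mem`). Hence
cochains and coderivations correspond bijectively degree by degree (`eq_cochainCoder`).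

The corestriction of the composite of the coderivations of `f` and `g` is `f ∘ g`, with exactly the
Gerstenhaber signs. Commutators of coderivations are coderivations, so comparing corestrictions
shows that brackets match (`cochainCoder_gerstenhaber`). With `χ` the coderivation of `μ`, the same
comparison identifies `[χ, -]` with `δ`, because `δf = [μ, f]` (`hochschild_apply_seq`). Moreover
`[χ, χ] = 2χ²` has the associator of `μ` as corestriction, so `χ² = 0` once `2` is invertible.

The dg-Lie axioms are formal for graded commutators and a square-zero `χ` of degree `1`
(`isDGLie_coder`); those of the Hochschild side, including `δ² = 0` and Jacobi, are pulled back
along the isomorphism. Naturality is checked insertion by insertion on words. -/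

/-- The word `↓v₀ ⊗ … ⊗ ↓v_N` in `T(↓V)` formed by the first `N + 1` terms of a sequence. -/
def seqWord (v : ℕ → V) (N : ℕ) : TensorSum k (Desusp V) :=
  tensorIncl k (Desusp V) N (PiTensorProduct.tprod k fun j : Fin (N + 1) => down k (v j))

/-- Taking letters from a sequence on `ℕ` makes shifts and insertions free of casts between `Fin`
types. The letters beyond position `N` do not enter the word, so the padding by `0` is arbitrary. -/
theorem exists_seq_eq {N : ℕ} (w : Fin (N + 1) → Desusp V) :
    ∃ v : ℕ → V, w = fun j : Fin (N + 1) => down k (v j) := by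
  refine ⟨fun j => if hj : j < N + 1 then (down k).symm (w ⟨j, hj⟩) else 0, ?_⟩
  funext j
  simp [Nat.lt_succ_iff.1 j.2]

/-- Linear maps out of `T(↓V)` that agree on words are equal. -/
theorem linearMap_ext_seqWord {E : Type*} [AddCommMonoid E] [Module k E]
    {f g : TensorSum k (Desusp V) →ₗ[k] E}
    (h : ∀ v N, f (seqWord k v N) = g (seqWord k v N)) : f = g := by
  refine DirectSum.linearMap_ext k fun N => PiTensorProduct.ext (MultilinearMap.ext fun w => ?_)
  obtain ⟨v, rfl⟩ := exists_seq_eq k w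
  exact h v N

theorem seqWord_congr {v w : ℕ → V} {N : ℕ} (h : ∀ j ≤ N, v j = w j) :
    seqWord k v N = seqWord k w N := by
  unfold seqWord
  congr 2
  funext j
  rw [h j (by omega)]

theorem seqWord_mem (v : ℕ → V) (N : ℕ) :
    seqWord k v N ∈ tensorGrading k V (-((N : ℤ) + 1)) :=
  lof_mem_sumGrading k (fun n : ℕ => ⨂[k]^(n + 1) (Desusp V)) (fun n => -((n : ℤ) + 1)) N _

theorem tensorComul_seqWord (v : ℕ → V) (N : ℕ) :
    tensorComul k (Desusp V) (seqWord k v N) = ∑ i ∈ Finset.range N,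
      seqWord k v i ⊗ₜ[k] seqWord k (fun j => v (i + 1 + j)) (N - 1 - i) := by
  rw [seqWord, tensorComul_tprod, ← Fin.sum_univ_eq_sum_range (fun i =>
    seqWord k v i ⊗ₜ[k] seqWord k (fun j => v (i + 1 + j)) (N - 1 - i))]
  rfl

theorem tensorProj_seqWord_zero (v : ℕ → V) :
    tensorProj k (Desusp V) (seqWord k v 0) = down k (v 0) := by
  simp only [tensorProj, seqWord, tensorIncl, LinearMap.comp_apply, DirectSum.component.lof_self,
    LinearEquiv.coe_coe]
  erw [PiTensorProduct.subsingletonEquiv_apply_tprod]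
  rfl

theorem tensorProj_seqWord_of_ne (v : ℕ → V) {N : ℕ} (h : N ≠ 0) :
    tensorProj k (Desusp V) (seqWord k v N) = 0 := by
  simp only [tensorProj, seqWord, tensorIncl, LinearMap.comp_apply, LinearEquiv.coe_coe]
  rw [DirectSum.component.of, dif_neg h, map_zero]

theorem tensorProj_seqWord (v : ℕ → V) (N : ℕ) :
    tensorProj k (Desusp V) (seqWord k v N) = if N = 0 then down k (v 0) else 0 := by
  split_ifs with h
  · rw [h, tensorProj_seqWord_zero]
  · exact tensorProj_seqWord_of_ne k v h

theorem neg_one_zpow_neg (z : ℤ) : (-1 : k) ^ (-z) = (-1 : k) ^ z := by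
  rw [zpow_neg, ← inv_zpow, inv_neg_one]

/-- The degree of the word is `-(N + 1)`, but the parity of an exponent does not see its sign, so
the Koszul sign becomes a power with a natural exponent. -/
theorem koszulMap_seqWord (n N : ℕ) (v : ℕ → V) :
    koszulMap k (tensorGrading k V) n (seqWord k v N)
      = (-1 : k) ^ (n * (N + 1)) • seqWord k v N := by
  rw [koszulMap_of_mem k _ _ _ _ (seqWord_mem k v N), mul_neg, neg_one_zpow_neg]
  congr 1
  exact_mod_cast rfl

theorem corestriction_ext {θ φ : Module.End k (TensorSum k (Desusp V))} {n : ℕ}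
    (h : ∀ v, tensorProj k (Desusp V) (θ (seqWord k v n))
      = tensorProj k (Desusp V) (φ (seqWord k v n))) :
    corestriction k (Desusp V) θ n = corestriction k (Desusp V) φ n := by
  refine PiTensorProduct.ext (MultilinearMap.ext fun w => ?_)
  obtain ⟨v, rfl⟩ := exists_seq_eq k w
  exact h v

theorem corestriction_tprod_down (θ : Module.End k (TensorSum k (Desusp V))) (v : ℕ → V) (n : ℕ) :
    corestriction k (Desusp V) θ n (PiTensorProduct.tprod k fun j : Fin (n + 1) => down k (v j))
      = tensorProj k (Desusp V) (θ (seqWord k v n)) := rfl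

end Words

/-! ### Coderivations are determined by their corestrictions -/

section Uniqueness

variable (k : Type u) [Field k]

theorem deconcat_injective (W : Type v) [AddCommGroup W] [Module k W] (n : ℕ) (i : Fin n) :
    Function.Injective (deconcat k W n i) := by
  simp only [deconcat, LinearMap.coe_comp, LinearEquiv.coe_coe]
  exact (LinearEquiv.injective _).comp (LinearEquiv.injective _)

theorem component_comp_tensorIncl (W : Type v) [AddCommGroup W] [Module k W] (a : ℕ) :
    DirectSum.component k ℕ (fun n => ⨂[k]^(n + 1) W) a ∘ₗ tensorIncl k W a = LinearMap.id :=
  LinearMap.ext fun y => by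
    rw [LinearMap.comp_apply, tensorIncl, LinearMap.id_apply, DirectSum.component.lof_self]

theorem component_comp_tensorIncl_of_ne (W : Type v) [AddCommGroup W] [Module k W] {a b : ℕ}
    (h : a ≠ b) :
    DirectSum.component k ℕ (fun n => ⨂[k]^(n + 1) W) b ∘ₗ tensorIncl k W a = 0 :=
  LinearMap.ext fun y => by
    rw [LinearMap.comp_apply, tensorIncl, LinearMap.zero_apply, DirectSum.component.of, dif_neg h]

/-- The lengths of the two factors determine both the length of the word and the place of the cut.
So a bihomogeneous component of `Δ` sees a single summand of `T(W)` and is one deconcatenation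
there. -/
theorem component_comp_tensorComul (W : Type v) [AddCommGroup W] [Module k W] (n : ℕ)
    (i : Fin n) :
    TensorProduct.map (DirectSum.component k ℕ (fun n => ⨂[k]^(n + 1) W) i)
        (DirectSum.component k ℕ (fun n => ⨂[k]^(n + 1) W) (n - 1 - i)) ∘ₗ tensorComul k W
      = deconcat k W n i ∘ₗ DirectSum.component k ℕ (fun n => ⨂[k]^(n + 1) W) n := by
  refine DirectSum.linearMap_ext k fun m => ?_
  have hlof : tensorComul k W ∘ₗ DirectSum.lof k ℕ (fun n => ⨂[k]^(n + 1) W) m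
      = ∑ j : Fin m, TensorProduct.map (tensorIncl k W j) (tensorIncl k W (m - 1 - j)) ∘ₗ
        deconcat k W m j :=
    LinearMap.ext fun x => DirectSum.toModule_lof k _ _
  rw [LinearMap.comp_assoc, hlof, LinearMap.comp_assoc]
  change _ = _ ∘ₗ DirectSum.component k ℕ (fun n => ⨂[k]^(n + 1) W) n ∘ₗ tensorIncl k W m
  have hsum : ∀ (f : TensorSum k W ⊗[k] TensorSum k W →ₗ[k]
        (⨂[k]^(i + 1) W) ⊗[k] (⨂[k]^(n - 1 - i + 1) W))
      (g : Fin m → ⨂[k]^(m + 1) W →ₗ[k] TensorSum k W ⊗[k] TensorSum k W),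
      f ∘ₗ ∑ j, g j = ∑ j, f ∘ₗ g j := fun f g =>
    LinearMap.ext fun x => by simp only [LinearMap.comp_apply, LinearMap.sum_apply, map_sum]
  rw [hsum]
  simp only [← LinearMap.comp_assoc, ← TensorProduct.map_comp]
  by_cases hm : m = n
  · subst hm
    rw [Finset.sum_eq_single i]
    · rw [LinearMap.comp_assoc, component_comp_tensorIncl, component_comp_tensorIncl,
        component_comp_tensorIncl, TensorProduct.map_id, LinearMap.id_comp, LinearMap.comp_id]
    · intro j _ hj
      rw [component_comp_tensorIncl_of_ne k W fun h => hj (Fin.ext h),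
        TensorProduct.map_zero_left, LinearMap.zero_comp]
    · simp
  · rw [LinearMap.comp_assoc, component_comp_tensorIncl_of_ne k W hm, LinearMap.comp_zero]
    refine Finset.sum_eq_zero fun j _ => ?_
    -- For words of another length, a cut that matches in the first factor must fail in the second.
    by_cases hj : (j : ℕ) = i
    · rw [component_comp_tensorIncl_of_ne k W (a := m - 1 - j) (b := n - 1 - i)
        (by have := i.2; have := j.2; omega), TensorProduct.map_zero_right, LinearMap.zero_comp]
    · rw [component_comp_tensorIncl_of_ne k W hj, TensorProduct.map_zero_left,
        LinearMap.zero_comp]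

/-- The primitive elements of `T(W)` lie in `W`. -/
theorem eq_zero_of_tensorComul_eq_zero (W : Type v) [AddCommGroup W] [Module k W]
    (x : TensorSum k W) (h : tensorComul k W x = 0) (h' : tensorProj k W x = 0) : x = 0 := by
  refine DFinsupp.ext fun n => ?_
  cases n with
  | zero =>
    rw [tensorProj, LinearMap.comp_apply, LinearEquiv.coe_coe, LinearEquiv.map_eq_zero_iff] at h'
    exact h'
  | succ n =>
    -- Words with at least two letters can be cut after the first letter, and this cut alone
    -- recovers the component.
    refine deconcat_injective k W (n + 1) ⟨0, n.succ_pos⟩ ?_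
    have := LinearMap.congr_fun (component_comp_tensorComul k W (n + 1) ⟨0, n.succ_pos⟩) x
    rw [LinearMap.comp_apply, h, map_zero] at this
    exact this.symm.trans (map_zero _).symm

variable {k} {V : Type v} [AddCommGroup V] [Module k V]

/-- Induction on the length of the word: the coderivation rule expresses `Δθ(w)` through `θ` on
proper subwords, so `θ(w) - φ(w)` is primitive. Its projection to `↓V` vanishes because the
corestrictions agree, hence so does the difference. The common degree `d` makes the Koszul signs in
the two rules coincide. -/
theorem coder_ext {d : ℤ} {θ φ : Module.End k (TensorSum k (Desusp V))}
    (hθ : θ ∈ TCoDer k V d) (hφ : φ ∈ TCoDer k V d)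
    (h : ∀ n, corestriction k (Desusp V) θ n = corestriction k (Desusp V) φ n) : θ = φ := by
  refine linearMap_ext_seqWord k fun v N => ?_
  induction N using Nat.strong_induction_on generalizing v with
  | _ N ih =>
    refine sub_eq_zero.1 (eq_zero_of_tensorComul_eq_zero k _ _ ?_ ?_)
    · have h1 := LinearMap.congr_fun hθ.2 (seqWord k v N)
      have h2 := LinearMap.congr_fun hφ.2 (seqWord k v N)
      simp only [LinearMap.comp_apply, LinearMap.add_apply, tensorComul_seqWord, map_sum,
        TensorProduct.map_tmul] at h1 h2
      rw [map_sub, sub_eq_zero, h1, h2]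
      congr 1
      · exact Finset.sum_congr rfl fun i hi => by rw [ih i (Finset.mem_range.1 hi)]
      · refine Finset.sum_congr rfl fun i hi => ?_
        rw [Finset.mem_range] at hi
        rw [ih (N - 1 - i) (by omega)]
    · rw [map_sub, sub_eq_zero, ← corestriction_tprod_down, ← corestriction_tprod_down, h N]

/-- A linear map of degree `d` has only a `(d + 1)`st corestriction. -/
theorem corestriction_eq_zero {d : ℤ} {θ : Module.End k (TensorSum k (Desusp V))}
    (hθ : θ ∈ TCoDer k V d) {n : ℕ} (h : d ≠ n) : corestriction k (Desusp V) θ n = 0 := by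
  refine PiTensorProduct.ext (MultilinearMap.ext fun w => ?_)
  obtain ⟨v, rfl⟩ := exists_seq_eq k w
  -- Index `0` is the summand `↓V` of degree `-1`, whereas the image of a word of degree `-(n + 1)`
  -- has degree `d - (n + 1)`; these meet only for `d = n`.
  have h1 : θ (seqWord k v n) 0 = 0 := by
    by_contra h2
    have := hθ.1 _ _ (seqWord_mem k v n) 0 h2
    push_cast at this
    omega
  change tensorProj k _ (θ (seqWord k v n)) = 0
  rw [tensorProj, LinearMap.comp_apply, LinearEquiv.coe_coe]
  exact (congrArg _ h1).trans (map_zero _)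

end Uniqueness

/-! ### The coderivation of a cochain -/

section CochainCoder

variable (k : Type u) [Field k] {V : Type v} [AddCommGroup V] [Module k V]

/-- The sequence `v₀, …, vᵢ₋₁, g(vᵢ, …, vᵢ₊ₙ), vᵢ₊ₙ₊₁, …`. -/
def insertSeq {V : Type v} {n : ℕ} (i : ℕ) (g : (Fin (n + 1) → V) → V) (v : ℕ → V) (j : ℕ) : V :=
  if j < i then v j else if j = i then g fun l => v (i + l) else v (j + n)

/-- The multilinear map `v ↦ ↓v₀ ⊗ … ⊗ ↓φ(vᵢ, …, vᵢ₊ₙ) ⊗ … ⊗ ↓vₘ₊ₙ`. -/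
def insertTensor {m n : ℕ} (i : Fin (m + 1)) (φ : Cochain k V n) :
    MultilinearMap k (fun _ : Fin (m + n + 1) => V) (TensorSum k (Desusp V)) :=
  MultilinearMap.mk' (fun v => ((tensorIncl k (Desusp V) m).compMultilinearMap
      ((PiTensorProduct.tprod k).compLinearMap fun _ => (down k).toLinearMap)) (insertWord i φ v))
    (by
      intro v a x y
      simp only [insertWord_update]
      split_ifs <;> simp only [MultilinearMap.map_update_add])
    (by
      intro v a c x
      simp only [insertWord_update]
      split_ifs <;> simp only [MultilinearMap.map_update_smul])

/-- The restriction to words with `N + 1` letters of the coderivation of a cochain. -/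
def cochainCoderOn {n : ℕ} (φ : Cochain k V n) (N : ℕ) :
    ⨂[k]^(N + 1) (Desusp V) →ₗ[k] TensorSum k (Desusp V) :=
  -- An input word of `N + 1` letters yields words of `N - n + 1` letters, one for each place of
  -- insertion. The sign is the Koszul sign of a map of degree `n` passing `i` letters of degree
  -- `-1`. Words too short for `φ` go to `0`.
  if h : n ≤ N then
    PiTensorProduct.lift (((∑ i : Fin (N - n + 1), (-1 : k) ^ (n * (i : ℕ)) •
      insertTensor k i φ).domDomCongr (finCongr (by omega))).compLinearMap
        fun _ => (down k).symm.toLinearMap)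
  else 0

/-- The linear map underlying the coderivation of `T(↓V)` with corestriction `φ`. -/
def cochainCoder {n : ℕ} (φ : Cochain k V n) : Module.End k (TensorSum k (Desusp V)) :=
  DirectSum.toModule k ℕ _ (cochainCoderOn k φ)

/-- For `N < n` the truncated difference `N + 1 - n` is `0`, so the empty sum covers the words that
are too short and one formula holds for all `N`. -/
theorem cochainCoder_seqWord {n : ℕ} (φ : Cochain k V n) (v : ℕ → V) (N : ℕ) :
    cochainCoder k φ (seqWord k v N) = ∑ i ∈ Finset.range (N + 1 - n),
      (-1 : k) ^ (n * i) • seqWord k (insertSeq i φ v) (N - n) := by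
  rw [cochainCoder, seqWord, tensorIncl, DirectSum.toModule_lof, cochainCoderOn]
  split_ifs with h
  · rw [PiTensorProduct.lift.tprod, show N + 1 - n = N - n + 1 by omega,
      ← Fin.sum_univ_eq_sum_range (fun i => (-1 : k) ^ (n * i) •
        seqWord k (insertSeq i φ v) (N - n))]
    simp only [MultilinearMap.compLinearMap_apply, MultilinearMap.domDomCongr_apply,
      sum_apply, smul_apply]
    rfl
  · rw [show N + 1 - n = 0 by omega]
    simp

theorem tensorProj_cochainCoder {n : ℕ} (φ : Cochain k V n) (v : ℕ → V) (N : ℕ) :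
    tensorProj k (Desusp V) (cochainCoder k φ (seqWord k v N))
      = if N = n then down k (φ fun l => v l) else 0 := by
  rw [cochainCoder_seqWord]
  split_ifs with h
  · subst h
    simp [tensorProj_seqWord, insertSeq]
  · simp only [map_sum, map_smul, tensorProj_seqWord]
    refine Finset.sum_eq_zero fun i hi => ?_
    rw [Finset.mem_range] at hi
    rw [if_neg (by omega), smul_zero]

theorem corestriction_cochainCoder {n : ℕ} (φ : Cochain k V n) (a : Fin (n + 1) → V) :
    corestriction k (Desusp V) (cochainCoder k φ) n
      (PiTensorProduct.tprod k fun i => down k (a i)) = down k (φ a) := by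
  obtain ⟨v, rfl⟩ : ∃ v : ℕ → V, a = fun i : Fin (n + 1) => v i :=
    exists_seq_eq k fun i => down k (a i)
  rw [corestriction_tprod_down, tensorProj_cochainCoder, if_pos rfl]

theorem corestriction_cochainCoder_of_ne {n : ℕ} (φ : Cochain k V n) {s : ℕ} (h : s ≠ n) :
    corestriction k (Desusp V) (cochainCoder k φ) s = 0 := by
  rw [corestriction_ext k (φ := 0) fun v => by
    rw [tensorProj_cochainCoder, if_neg h, LinearMap.zero_apply, map_zero]]
  simp [corestriction]

theorem hasDegree_cochainCoder {n : ℕ} (φ : Cochain k V n) :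
    HasDegree (tensorGrading k V) n (cochainCoder k φ) := by
  have hN : ∀ (N : ℕ) (x : ⨂[k]^(N + 1) (Desusp V)),
      cochainCoder k φ (tensorIncl k _ N x) ∈ tensorGrading k V (-((N : ℤ) + 1) + n) := by
    intro N x
    induction x using PiTensorProduct.induction_on with
    | smul_tprod r w =>
      rw [map_smul, map_smul]
      refine Submodule.smul_mem _ _ ?_
      obtain ⟨v, rfl⟩ := exists_seq_eq k w
      change cochainCoder k φ (seqWord k v N) ∈ _
      rw [cochainCoder_seqWord]
      refine Submodule.sum_mem _ fun i hi => Submodule.smul_mem _ _ ?_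
      rw [Finset.mem_range] at hi
      rw [show -((N : ℤ) + 1) + n = -(((N - n : ℕ) : ℤ) + 1) by omega]
      exact seqWord_mem k _ _
    | add x y hx hy =>
      rw [map_add, map_add]
      exact Submodule.add_mem _ hx hy
  intro i c hc
  classical
  rw [← DirectSum.sum_support_of c, map_sum]
  refine Submodule.sum_mem _ fun N hmem => ?_
  rw [← hc N (DFinsupp.mem_support_iff.1 hmem)]
  exact hN N _

theorem insertSeq_add_left {V : Type v} {n : ℕ} (i a : ℕ) (g : (Fin (n + 1) → V) → V)
    (v : ℕ → V) (j : ℕ) :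
    insertSeq (a + i) g v (a + j) = insertSeq i g (fun l => v (a + l)) j := by
  unfold insertSeq
  simp only [add_lt_add_iff_left, add_right_inj, add_assoc]

/-- Inserting `φ` at `i` and then cutting after letter `j` of the result is the same as cutting
first. For `i ≤ j` the insertion falls into the left factor and the cut of the original word is
after letter `j + n`; for `i > j` it falls into the right factor and the cut is after letter `j`. -/
theorem tensorComul_cochainCoder_seqWord {n : ℕ} (φ : Cochain k V n) (v : ℕ → V) (M : ℕ) :
    tensorComul k (Desusp V) (cochainCoder k φ (seqWord k v (M + n)))
      = TensorProduct.map (cochainCoder k φ) LinearMap.id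
          (tensorComul k (Desusp V) (seqWord k v (M + n)))
        + TensorProduct.map (koszulMap k (tensorGrading k V) n) (cochainCoder k φ)
          (tensorComul k (Desusp V) (seqWord k v (M + n))) := by
  simp only [cochainCoder_seqWord, tensorComul_seqWord, map_sum, map_smul, TensorProduct.map_tmul,
    LinearMap.id_apply, koszulMap_seqWord, TensorProduct.sum_tmul, TensorProduct.tmul_sum,
    Finset.smul_sum, Nat.add_sub_cancel]
  rw [show M + n + 1 - n = M + 1 by omega, Finset.sum_comm]
  -- In the left-factor sum, cuts whose left factor has at most `n` letters contribute nothing; the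
  -- remaining ones are reindexed by the cut of the output word.
  have h1 : ∀ F : ℕ → TensorSum k (Desusp V) ⊗[k] TensorSum k (Desusp V),
      (∀ a < n, F a = 0) → ∑ a ∈ Finset.range (M + n), F a = ∑ a ∈ Finset.range M, F (a + n) := by
    intro F hF
    rw [add_comm M n, Finset.sum_range_add,
      Finset.sum_eq_zero fun a ha => hF a (Finset.mem_range.1 ha), zero_add]
    exact Finset.sum_congr rfl fun a _ => by rw [add_comm]
  -- Likewise for the right-factor sum: a cut at `M` or later leaves at most `n` letters on the
  -- right.
  have h2 : ∀ F : ℕ → TensorSum k (Desusp V) ⊗[k] TensorSum k (Desusp V),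
      (∀ a, M ≤ a → a < M + n → F a = 0) →
      ∑ a ∈ Finset.range (M + n), F a = ∑ a ∈ Finset.range M, F a := by
    intro F hF
    rw [Finset.sum_range_add, Finset.sum_eq_zero (s := Finset.range n) fun a ha =>
      hF _ (by omega) (by have := Finset.mem_range.1 ha; omega), add_zero]
  rw [h1 _ fun a ha => by rw [show a + 1 - n = 0 by omega, Finset.sum_range_zero],
    h2 _ fun a ha ha' => by
      rw [show M + n - 1 - a + 1 - n = 0 by omega, Finset.sum_range_zero], ← Finset.sum_add_distrib]
  refine Finset.sum_congr rfl fun j hj => ?_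
  rw [Finset.mem_range] at hj
  -- The insertion places are split at the cut: the first `j + 1` of them lie in the left factor,
  -- the other `M - j` in the right one.
  rw [show M + 1 = (j + 1) + (M - j) by omega, Finset.sum_range_add,
    show j + n + 1 - n = j + 1 by omega, show M + n - 1 - j + 1 - n = M - j by omega,
    show M + n - 1 - j - n = M - 1 - j by omega, show M + n - 1 - (j + n) = M - 1 - j by omega,
    Nat.add_sub_cancel]
  congr 1
  · refine Finset.sum_congr rfl fun i hi => ?_
    rw [Finset.mem_range] at hi
    rw [TensorProduct.smul_tmul']
    congr 2
    funext l
    rw [insertSeq, if_neg (by omega), if_neg (by omega)]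
    congr 1
    omega
  · refine Finset.sum_congr rfl fun i hi => ?_
    rw [TensorProduct.tmul_smul, ← TensorProduct.smul_tmul', smul_smul]
    congr 1
    -- The sign `(-1)^(n(j + 1))` from the Koszul map on the left factor accounts for the shift
    -- between the insertion place in the right factor and that in the whole word.
    · rw [← pow_add]
      congr 1
      ring
    · congr 1
      · exact seqWord_congr k fun l hl => by rw [insertSeq, if_pos (by omega)]
      · exact seqWord_congr k fun l _ => insertSeq_add_left _ _ _ _ _

theorem cochainCoder_mem {n : ℕ} (φ : Cochain k V n) : cochainCoder k φ ∈ TCoDer k V n := by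
  refine ⟨hasDegree_cochainCoder k φ, linearMap_ext_seqWord k fun v N => ?_⟩
  simp only [LinearMap.comp_apply, LinearMap.add_apply]
  by_cases h : n ≤ N
  · obtain ⟨M, rfl⟩ := Nat.exists_eq_add_of_le' h
    exact tensorComul_cochainCoder_seqWord k φ v M
  · have h0 : ∀ a ≤ N, ∀ w, cochainCoder k φ (seqWord k w a) = 0 := by
      intro a ha w
      rw [cochainCoder_seqWord, show a + 1 - n = 0 by omega, Finset.sum_range_zero]
    simp only [tensorComul_seqWord, map_sum, TensorProduct.map_tmul]
    rw [h0 N le_rfl, map_zero, Finset.sum_eq_zero, Finset.sum_eq_zero, add_zero]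
    · intro i _
      rw [h0 _ (by omega), TensorProduct.tmul_zero]
    · intro i hi
      rw [h0 i (Finset.mem_range.1 hi).le, TensorProduct.zero_tmul]

/-- A coderivation of degree `n` is the coderivation of its `(n + 1)`st corestriction. -/
theorem eq_cochainCoder {n : ℕ} {φ : Cochain k V n} {θ : Module.End k (TensorSum k (Desusp V))}
    (hθ : θ ∈ TCoDer k V n)
    (h : ∀ v : ℕ → V, tensorProj k (Desusp V) (θ (seqWord k v n)) = down k (φ fun l => v l)) :
    θ = cochainCoder k φ := by
  refine coder_ext hθ (cochainCoder_mem k φ) fun s => ?_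
  by_cases hs : s = n
  · subst hs
    exact corestriction_ext k fun v => by rw [h, tensorProj_cochainCoder, if_pos rfl]
  · rw [corestriction_cochainCoder_of_ne k φ hs,
      corestriction_eq_zero hθ fun e => hs (by exact_mod_cast e.symm)]

/-- The `(n + 1)`st corestriction of an endomorphism of `T(↓V)`, as a cochain. -/
def corestrictionCochain (n : ℕ) :
    Module.End k (TensorSum k (Desusp V)) →ₗ[k] Cochain k V n where
  toFun θ := (((down k).symm.toLinearMap ∘ₗ corestriction k (Desusp V) θ n).compMultilinearMap
    (PiTensorProduct.tprod k)).compLinearMap fun _ => (down k).toLinearMap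
  map_add' θ φ := MultilinearMap.ext fun a => by
    change (down k).symm (tensorProj k _ (θ _ + φ _)) = (down k).symm (tensorProj k _ (θ _))
      + (down k).symm (tensorProj k _ (φ _))
    rw [map_add, map_add]
  map_smul' c θ := MultilinearMap.ext fun a => by
    change (down k).symm (tensorProj k _ (c • θ _)) = c • (down k).symm (tensorProj k _ (θ _))
    rw [map_smul, map_smul]

theorem corestrictionCochain_apply (n : ℕ) (θ : Module.End k (TensorSum k (Desusp V)))
    (a : Fin (n + 1) → V) :
    down k (corestrictionCochain k n θ a) = corestriction k (Desusp V) θ n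
      (PiTensorProduct.tprod k fun i => down k (a i)) := rfl

theorem corestrictionCochain_cochainCoder {n : ℕ} (φ : Cochain k V n) :
    corestrictionCochain k n (cochainCoder k φ) = φ :=
  MultilinearMap.ext fun a => (down k).injective (by
    rw [corestrictionCochain_apply, corestriction_cochainCoder])

theorem cochainCoder_corestrictionCochain {n : ℕ} {θ : Module.End k (TensorSum k (Desusp V))}
    (hθ : θ ∈ TCoDer k V n) : cochainCoder k (corestrictionCochain k n θ) = θ :=
  (eq_cochainCoder k hθ fun _ => rfl).symm

/-- A cochain as a coderivation of `T(↓V)`. -/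
def cochainToCoder (n : ℕ) : Cochain k V n →ₗ[k] TCoDer k V n where
  toFun φ := ⟨cochainCoder k φ, cochainCoder_mem k φ⟩
  -- Linearity is not computed on words: both sides are coderivations of degree `n` with the same
  -- corestriction.
  map_add' φ ψ := Subtype.ext (eq_cochainCoder k ((TCoDer k V n).add_mem (cochainCoder_mem k φ)
    (cochainCoder_mem k ψ)) fun v => by
      simp only [LinearMap.add_apply, map_add, tensorProj_cochainCoder, if_true]
      rfl).symm
  map_smul' c φ := Subtype.ext (eq_cochainCoder k ((TCoDer k V n).smul_mem c
    (cochainCoder_mem k φ)) fun v => by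
      simp only [LinearMap.smul_apply, map_smul, tensorProj_cochainCoder, if_true]
      rfl).symm

end CochainCoder

/-! ### Homogeneous elements of direct sums -/

section Homogeneous

variable (k : Type u) [Field k] {ι : Type} [DecidableEq ι] (M : ι → Type v)
  [∀ n, AddCommGroup (M n)] [∀ n, Module k (M n)]

/-- Injectivity of `deg` makes each homogeneous part a single summand, so identities between
homogeneous elements can be checked on the images of `lof`. -/
theorem exists_eq_lof {deg : ι → ℤ} (hdeg : Function.Injective deg) (n : ι) {a : ⨁ n, M n}
    (ha : a ∈ sumGrading k M deg (deg n)) : ∃ x, a = DirectSum.lof k ι M n x := by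
  refine ⟨a n, DFinsupp.ext fun m => ?_⟩
  change a m = DirectSum.component k ι M m (DirectSum.lof k ι M n (a n))
  rw [DirectSum.component.of]
  split_ifs with h
  · subst h
    rfl
  · by_contra hm
    exact h (hdeg (ha m hm)).symm

end Homogeneous

/-! ### The dg-Lie algebra of coderivations -/

section CoderLie

variable (k : Type u) [Field k] {C : Type v} [AddCommGroup C] [Module k C]
  (𝒞 : ℤ → Submodule k C) [DirectSum.Decomposition 𝒞] (Δ : C →ₗ[k] C ⊗[k] C)

/-- Degrees such as `a + b` and `b + a` give different types of coderivations. This reduces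
equations in the direct sum to equations between the underlying endomorphisms, without transport. -/
theorem lof_coder_congr {d e : ℤ} (h : d = e) {x : CoDer k 𝒞 Δ d} {y : CoDer k 𝒞 Δ e}
    (hxy : (x : Module.End k C) = y) :
    DirectSum.lof k ℤ (fun d => CoDer k 𝒞 Δ d) d x
      = DirectSum.lof k ℤ (fun d => CoDer k 𝒞 Δ d) e y := by
  subst h
  rw [Subtype.ext hxy]

theorem coderSumBracket_lof {a b : ℤ} (x : CoDer k 𝒞 Δ a) (y : CoDer k 𝒞 Δ b) :
    coderSumBracket k 𝒞 Δ (DirectSum.lof k ℤ (fun d => CoDer k 𝒞 Δ d) a x)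
        (DirectSum.lof k ℤ (fun d => CoDer k 𝒞 Δ d) b y)
      = DirectSum.lof k ℤ (fun d => CoDer k 𝒞 Δ d) (a + b) (coderBracket k 𝒞 Δ a b x y) :=
  sumBilin_lof k (fun d => CoDer k 𝒞 Δ d) (coderBracket k 𝒞 Δ) a b x y

theorem coe_coderBracket {a b : ℤ} (x : CoDer k 𝒞 Δ a) (y : CoDer k 𝒞 Δ b) :
    (coderBracket k 𝒞 Δ a b x y : Module.End k C)
      = (x : Module.End k C) * y - (-1 : k) ^ (a * b) • ((y : Module.End k C) * x) := rfl

theorem neg_one_zpow_eq_or (z : ℤ) : (-1 : k) ^ z = 1 ∨ (-1 : k) ^ z = -1 := by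
  rcases Int.even_or_odd z with h | h
  · exact Or.inl h.neg_one_zpow
  · exact Or.inr h.neg_one_zpow

theorem neg_one_zpow_add (a b : ℤ) : (-1 : k) ^ (a + b) = (-1 : k) ^ a * (-1 : k) ^ b :=
  zpow_add₀ (by simp) a b

theorem coderSumBracket_antisymm {i j : ℤ} (x : CoDer k 𝒞 Δ i) (y : CoDer k 𝒞 Δ j) :
    coderSumBracket k 𝒞 Δ (DirectSum.lof k ℤ (fun d => CoDer k 𝒞 Δ d) i x)
        (DirectSum.lof k ℤ (fun d => CoDer k 𝒞 Δ d) j y)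
      = -((-1 : k) ^ (i * j) • coderSumBracket k 𝒞 Δ
        (DirectSum.lof k ℤ (fun d => CoDer k 𝒞 Δ d) j y)
        (DirectSum.lof k ℤ (fun d => CoDer k 𝒞 Δ d) i x)) := by
  rw [coderSumBracket_lof, coderSumBracket_lof, ← map_smul, ← map_neg]
  refine lof_coder_congr k 𝒞 Δ (add_comm i j) ?_
  rw [Submodule.coe_neg, Submodule.coe_smul, coe_coderBracket, coe_coderBracket, mul_comm j i]
  rcases neg_one_zpow_eq_or k (i * j) with h | h <;> rw [h] <;> module

/-- The three terms are moved to the common degree `p + (q + r)`. What is left is the graded Jacobi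
identity for commutators in an associative algebra, where only the parities of `pq`, `pr` and `qr`
matter. -/
theorem coderSumBracket_jacobi {p q r : ℤ} (x : CoDer k 𝒞 Δ p) (y : CoDer k 𝒞 Δ q)
    (z : CoDer k 𝒞 Δ r) :
    let X := DirectSum.lof k ℤ (fun d => CoDer k 𝒞 Δ d) p x
    let Y := DirectSum.lof k ℤ (fun d => CoDer k 𝒞 Δ d) q y
    let Z := DirectSum.lof k ℤ (fun d => CoDer k 𝒞 Δ d) r z
    coderSumBracket k 𝒞 Δ X (coderSumBracket k 𝒞 Δ Y Z)
      + (-1 : k) ^ (p * (q + r)) • coderSumBracket k 𝒞 Δ Y (coderSumBracket k 𝒞 Δ Z X)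
      + (-1 : k) ^ (r * (p + q)) • coderSumBracket k 𝒞 Δ Z (coderSumBracket k 𝒞 Δ X Y) = 0 := by
  intro X Y Z
  simp only [X, Y, Z, coderSumBracket_lof]
  have e1 : q + (r + p) = p + (q + r) := by ring
  have e2 : r + (p + q) = p + (q + r) := by ring
  rw [lof_coder_congr k 𝒞 Δ e1 (y := ⟨_, e1 ▸ (coderBracket k 𝒞 Δ q (r + p) y _).2⟩) rfl,
    lof_coder_congr k 𝒞 Δ e2 (y := ⟨_, e2 ▸ (coderBracket k 𝒞 Δ r (p + q) z _).2⟩) rfl,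
    ← map_smul, ← map_smul, ← map_add, ← map_add]
  refine (congrArg _ (Subtype.ext ?_)).trans (map_zero _)
  simp only [Submodule.coe_add, Submodule.coe_smul, Submodule.coe_zero, coe_coderBracket]
  -- Every sign becomes a product of `(-1)^(pq)`, `(-1)^(pr)` and `(-1)^(qr)`. For each of the eight
  -- choices of these values, the identity is linear in the associative words in `x`, `y`, `z`.
  simp only [mul_add, neg_one_zpow_add, mul_comm q p, mul_comm r p, mul_comm r q, mul_sub,
    sub_mul, mul_smul_comm, smul_mul_assoc, smul_sub, smul_smul, ← mul_assoc]
  rcases neg_one_zpow_eq_or k (p * q) with h | h <;>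
    rcases neg_one_zpow_eq_or k (p * r) with h' | h' <;>
    rcases neg_one_zpow_eq_or k (q * r) with h'' | h'' <;>
    rw [h, h', h''] <;> module

/-- This form of the Jacobi identity says that `[c, -]` is a derivation of degree `r`; the case `r =
1` is the Leibniz rule for `[χ, -]`. -/
theorem coderSumBracket_leibniz {r i j : ℤ} (c : CoDer k 𝒞 Δ r) (x : CoDer k 𝒞 Δ i)
    (y : CoDer k 𝒞 Δ j) :
    let Z := DirectSum.lof k ℤ (fun d => CoDer k 𝒞 Δ d) r c
    let X := DirectSum.lof k ℤ (fun d => CoDer k 𝒞 Δ d) i x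
    let Y := DirectSum.lof k ℤ (fun d => CoDer k 𝒞 Δ d) j y
    coderSumBracket k 𝒞 Δ Z (coderSumBracket k 𝒞 Δ X Y)
      = coderSumBracket k 𝒞 Δ (coderSumBracket k 𝒞 Δ Z X) Y
        + (-1 : k) ^ (r * i) • coderSumBracket k 𝒞 Δ X (coderSumBracket k 𝒞 Δ Z Y) := by
  intro Z X Y
  simp only [X, Y, Z, coderSumBracket_lof]
  have e1 : r + i + j = r + (i + j) := by ring
  have e2 : i + (r + j) = r + (i + j) := by ring
  rw [lof_coder_congr k 𝒞 Δ e1 (y := ⟨_, e1 ▸ (coderBracket k 𝒞 Δ (r + i) j _ y).2⟩) rfl,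
    lof_coder_congr k 𝒞 Δ e2 (y := ⟨_, e2 ▸ (coderBracket k 𝒞 Δ i (r + j) x _).2⟩) rfl,
    ← map_smul, ← map_add]
  refine congrArg _ (Subtype.ext ?_)
  simp only [Submodule.coe_add, Submodule.coe_smul, coe_coderBracket]
  simp only [mul_add, add_mul, neg_one_zpow_add, mul_comm i r, mul_sub,
    sub_mul, mul_smul_comm, smul_mul_assoc, smul_sub, smul_smul, ← mul_assoc]
  rcases neg_one_zpow_eq_or k (r * i) with h | h <;>
    rcases neg_one_zpow_eq_or k (r * j) with h' | h' <;>
    rcases neg_one_zpow_eq_or k (i * j) with h'' | h'' <;>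
    rw [h, h', h''] <;> module

/-- In `[χ, [χ, x]]` the two terms `χxχ` have opposite signs and cancel because `χ` is odd; the
outer terms contain `χ²`. -/
theorem coderSumBracket_sq_zero (χ : CoDer k 𝒞 Δ 1)
    (hχ : (χ : Module.End k C) ∘ₗ (χ : Module.End k C) = 0) {i : ℤ} (x : CoDer k 𝒞 Δ i) :
    coderDifferential k 𝒞 Δ χ (coderDifferential k 𝒞 Δ χ
      (DirectSum.lof k ℤ (fun d => CoDer k 𝒞 Δ d) i x)) = 0 := by
  simp only [coderDifferential, coderSumBracket_lof]
  refine (congrArg _ (Subtype.ext ?_)).trans (map_zero _)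
  have h : (χ : Module.End k C) * (χ : Module.End k C) = 0 := hχ
  simp only [Submodule.coe_zero, coe_coderBracket, mul_sub, sub_mul, mul_smul_comm,
    smul_mul_assoc, ← mul_assoc, h]
  rw [mul_assoc (x : Module.End k C), h]
  simp only [one_mul, neg_one_zpow_add, zpow_one]
  simp

/-- The coderivations of a graded coalgebra form a dg-Lie algebra with differential `[χ, -]`. -/
theorem isDGLie_coder (χ : CoDer k 𝒞 Δ 1)
    (hχ : (χ : Module.End k C) ∘ₗ (χ : Module.End k C) = 0) :
    IsDGLie (L := CoDerSum k 𝒞 Δ) (coderGrading k 𝒞 Δ) (coderSumBracket k 𝒞 Δ)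
      (coderDifferential k 𝒞 Δ χ) := by
  have hex : ∀ (i : ℤ) (a : CoDerSum k 𝒞 Δ), a ∈ coderGrading k 𝒞 Δ i →
      ∃ x, a = DirectSum.lof k ℤ (fun d => CoDer k 𝒞 Δ d) i x := fun i a ha =>
    exists_eq_lof k (fun d => CoDer k 𝒞 Δ d) (deg := fun d => d) (fun _ _ h => h) i ha
  have hmem : ∀ (i : ℤ) (x : CoDer k 𝒞 Δ i),
      DirectSum.lof k ℤ (fun d => CoDer k 𝒞 Δ d) i x ∈ coderGrading k 𝒞 Δ i := fun i x =>
    lof_mem_sumGrading k (fun d => CoDer k 𝒞 Δ d) (fun d => d) i x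
  constructor
  · exact DirectSum.Decomposition.isInternal _
  · intro i j a ha b hb
    obtain ⟨x, rfl⟩ := hex i a ha
    obtain ⟨y, rfl⟩ := hex j b hb
    rw [coderSumBracket_lof]
    exact hmem _ _
  · intro i j a ha b hb
    obtain ⟨x, rfl⟩ := hex i a ha
    obtain ⟨y, rfl⟩ := hex j b hb
    exact coderSumBracket_antisymm k 𝒞 Δ x y
  · intro p q r a ha b hb c hc
    obtain ⟨x, rfl⟩ := hex p a ha
    obtain ⟨y, rfl⟩ := hex q b hb
    obtain ⟨z, rfl⟩ := hex r c hc
    exact coderSumBracket_jacobi k 𝒞 Δ x y z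
  · intro i a ha
    obtain ⟨x, rfl⟩ := hex i a ha
    rw [coderDifferential, coderSumBracket_lof, add_comm i 1]
    exact hmem _ _
  · intro i j a ha b hb
    obtain ⟨x, rfl⟩ := hex i a ha
    obtain ⟨y, rfl⟩ := hex j b hb
    have := coderSumBracket_leibniz k 𝒞 Δ χ x y
    rwa [one_mul] at this
  · intro a
    induction a using DirectSum.induction_on with
    | zero => rw [map_zero, map_zero]
    | of i x => exact coderSumBracket_sq_zero k 𝒞 Δ χ hχ x
    | add x y hx hy => rw [map_add, map_add, hx, hy, add_zero]

end CoderLie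

/-! ### Transport of dg-Lie structures -/

/-- A graded vector space that is isomorphic to a dg-Lie algebra is a dg-Lie algebra. -/
theorem IsDGLieIso.isDGLie {k : Type u} [Field k] {L : Type v} [AddCommGroup L] [Module k L]
    {L' : Type*} [AddCommGroup L'] [Module k L']
    {𝓛 : ℤ → Submodule k L} {br : L →ₗ[k] L →ₗ[k] L} {d : L →ₗ[k] L}
    {𝓛' : ℤ → Submodule k L'} {br' : L' →ₗ[k] L' →ₗ[k] L'} {d' : L' →ₗ[k] L'}
    {ξ : L ≃ₗ[k] L'} (hξ : IsDGLieIso 𝓛 br d 𝓛' br' d' ξ) (h : IsDGLie 𝓛' br' d')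
    (hint : DirectSum.IsInternal 𝓛) : IsDGLie 𝓛 br d where
  internal := hint
  br_mem i j a ha b hb := by
    rw [← hξ.map_grading] at *
    rw [hξ.map_br]
    exact h.br_mem i j _ ha _ hb
  antisymm i j a ha b hb := by
    apply ξ.injective
    rw [← hξ.map_grading] at *
    simpa only [map_neg, map_smul, hξ.map_br] using h.antisymm i j _ ha _ hb
  jacobi p q r a ha b hb c hc := by
    apply ξ.injective
    rw [← hξ.map_grading] at *
    simpa only [map_add, map_zero, map_smul, hξ.map_br] using h.jacobi p q r _ ha _ hb _ hc
  d_mem i a ha := by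
    rw [← hξ.map_grading] at *
    rw [hξ.map_d]
    exact h.d_mem i _ ha
  leibniz i j a ha b hb := by
    apply ξ.injective
    rw [← hξ.map_grading] at *
    simpa only [map_add, map_smul, hξ.map_br, hξ.map_d] using h.leibniz i j _ ha _ hb
  d_sq a := by
    apply ξ.injective
    simpa only [map_zero, hξ.map_d] using h.d_sq (ξ a)

/-! ### The isomorphism between cochains and coderivations -/

section Isomorphism

variable (k : Type u) [Field k] (V : Type v) [AddCommGroup V] [Module k V]

/-- The map `C^{*+1}(V, V) → CoDer^*(T(↓V))`. -/
def cochainSumToCoder : CochainSum k V →ₗ[k] TCoDerSum k V :=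
  DirectSum.toModule k ℕ _ fun n =>
    DirectSum.lof k ℤ (fun d => TCoDer k V d) n ∘ₗ cochainToCoder k n

/-- The map `CoDer^*(T(↓V)) → C^{*+1}(V, V)` given by corestriction. -/
def coderSumToCochain : TCoDerSum k V →ₗ[k] CochainSum k V :=
  DirectSum.toModule k ℤ _ fun d =>
    DirectSum.lof k ℕ (fun n => Cochain k V n) d.toNat ∘ₗ
      corestrictionCochain k d.toNat ∘ₗ (TCoDer k V d).subtype

theorem cochainSumToCoder_lof (n : ℕ) (φ : Cochain k V n) :
    cochainSumToCoder k V (DirectSum.lof k ℕ (fun n => Cochain k V n) n φ)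
      = DirectSum.lof k ℤ (fun d => TCoDer k V d) n (cochainToCoder k n φ) := by
  rw [cochainSumToCoder, DirectSum.toModule_lof]
  rfl

theorem coderSumToCochain_lof (d : ℤ) (θ : TCoDer k V d) :
    coderSumToCochain k V (DirectSum.lof k ℤ (fun d => TCoDer k V d) d θ)
      = DirectSum.lof k ℕ (fun n => Cochain k V n) d.toNat (corestrictionCochain k d.toNat θ) := by
  rw [coderSumToCochain, DirectSum.toModule_lof]
  rfl

variable {V} in
-- The `(n + 1)`st corestriction lives in degree `n ≥ 0`, so in negative degree all of them vanish.
-- This is why cochains indexed by `ℕ` can match coderivations indexed by `ℤ`.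
theorem coder_eq_zero_of_neg {d : ℤ} (hd : d < 0) {θ : Module.End k (TensorSum k (Desusp V))}
    (hθ : θ ∈ TCoDer k V d) : θ = 0 :=
  coder_ext hθ (TCoDer k V d).zero_mem fun n => by
    rw [corestriction_eq_zero hθ (by omega),
      corestriction_eq_zero (TCoDer k V d).zero_mem (by omega)]

/-- The isomorphism `ξ : C^{*+1}(V, V) ≃ CoDer^*(T(↓V))`. -/
def cochainCoderEquiv : CochainSum k V ≃ₗ[k] TCoDerSum k V :=
  LinearEquiv.ofLinearMap (cochainSumToCoder k V) (coderSumToCochain k V)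
    (DirectSum.linearMap_ext k fun d => LinearMap.ext fun θ => by
      simp only [LinearMap.comp_apply, LinearMap.id_apply, coderSumToCochain_lof,
        cochainSumToCoder_lof]
      rcases lt_or_ge d 0 with hd | hd
      · rw [show θ = 0 from Subtype.ext (coder_eq_zero_of_neg k hd θ.2)]
        simp
      · obtain ⟨n, rfl⟩ := Int.eq_ofNat_of_zero_le hd
        exact lof_coder_congr k _ _ rfl (cochainCoder_corestrictionCochain k θ.2))
    (DirectSum.linearMap_ext k fun n => LinearMap.ext fun φ => by
      simp only [LinearMap.comp_apply, LinearMap.id_apply, coderSumToCochain_lof,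
        cochainSumToCoder_lof]
      exact congrArg (DirectSum.lof k ℕ (fun n => Cochain k V n) n)
        (corestrictionCochain_cochainCoder k φ))

theorem cochainCoderEquiv_lof (n : ℕ) (φ : Cochain k V n) :
    cochainCoderEquiv k V (DirectSum.lof k ℕ (fun n => Cochain k V n) n φ)
      = DirectSum.lof k ℤ (fun d => TCoDer k V d) n (cochainToCoder k n φ) :=
  cochainSumToCoder_lof k V n φ

variable {V}

theorem cochainToCoder_injective (n : ℕ) :
    Function.Injective (cochainToCoder k (V := V) n) := fun φ ψ h => by
  rw [← corestrictionCochain_cochainCoder k φ, ← corestrictionCochain_cochainCoder k ψ]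
  exact congrArg (corestrictionCochain k n) (congrArg Subtype.val h)

theorem cochainCoderEquiv_apply (a : CochainSum k V) (n : ℕ) :
    cochainCoderEquiv k V a n = cochainToCoder k n (a n) := by
  have : DirectSum.component k ℤ (fun d => TCoDer k V d) n ∘ₗ (cochainSumToCoder k V)
      = cochainToCoder k n ∘ₗ DirectSum.component k ℕ (fun n => Cochain k V n) n := by
    refine DirectSum.linearMap_ext k fun m => LinearMap.ext fun φ => ?_
    simp only [LinearMap.comp_apply, cochainSumToCoder_lof]
    by_cases h : m = n
    · subst h
      rw [DirectSum.component.lof_self, DirectSum.component.lof_self]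
    · rw [DirectSum.component.of, dif_neg (by omega), DirectSum.component.of, dif_neg h, map_zero]
  exact LinearMap.congr_fun this a

theorem coe_cochainCoderEquiv_lof (n : ℕ) (φ : Cochain k V n) :
    (cochainCoderEquiv k V (DirectSum.lof k ℕ (fun n => Cochain k V n) n φ) n :
      Module.End k (TensorSum k (Desusp V))) = cochainCoder k φ := by
  rw [cochainCoderEquiv_lof]
  exact congrArg Subtype.val
    (DirectSum.component.lof_self (R := k) (M := fun d : ℤ => TCoDer k V d) (i := (n : ℤ)) (cochainToCoder k n φ))

/-- The isomorphism acts componentwise and injectively, so nonzero components correspond; on the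
coderivation side the components of negative degree vanish. -/
theorem cochainCoderEquiv_mem_iff (i : ℤ) (a : CochainSum k V) :
    cochainCoderEquiv k V a ∈ tCoDerGrading k V i ↔ a ∈ cochainGrading k V i := by
  constructor
  · intro h n hn
    refine h n ?_
    rw [cochainCoderEquiv_apply]
    exact fun h0 => hn (cochainToCoder_injective k n (h0.trans (map_zero _).symm))
  · intro h d hd
    rcases lt_or_ge d 0 with hd' | hd'
    · exact absurd (Subtype.ext (coder_eq_zero_of_neg k hd' (cochainCoderEquiv k V a d).2)) hd
    · obtain ⟨n, rfl⟩ := Int.eq_ofNat_of_zero_le hd'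
      refine h n fun h0 => hd ?_
      rw [cochainCoderEquiv_apply, h0, map_zero]

theorem isCoderivationOf_cochainToCoder {n : ℕ} (φ : Cochain k V n) :
    (∀ a : Fin (n + 1) → V, corestriction k (Desusp V) (cochainToCoder k n φ) n
      (PiTensorProduct.tprod k fun i => down k (a i)) = down k (φ a)) ∧
    ∀ s : ℕ, s ≠ n → corestriction k (Desusp V) (cochainToCoder k n φ) s = 0 :=
  ⟨corestriction_cochainCoder k φ, fun _ => corestriction_cochainCoder_of_ne k φ⟩

end Isomorphism

/-! ### Compatibility with the brackets and differentials -/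

section Bracket

variable (k : Type u) [Field k] {V : Type v} [AddCommGroup V] [Module k V]

/-- Inserting `g` leaves words of `m + 1` letters, on which the corestriction of the second
coderivation is `f`; the outcome is the signed sum defining `f ∘ g`. Length enters through an
equation so that both orders of composition apply to the same word. -/
theorem tensorProj_cochainCoder_comp {m n N : ℕ} (hN : N = m + n) (f : Cochain k V m)
    (g : Cochain k V n) (v : ℕ → V) :
    tensorProj k (Desusp V) (cochainCoder k f (cochainCoder k g (seqWord k v N)))
      = down k (∑ i ∈ Finset.range (m + 1), (-1 : k) ^ (n * i) •
        f fun l => insertSeq i g v l) := by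
  subst hN
  rw [cochainCoder_seqWord, show m + n + 1 - n = m + 1 by omega, Nat.add_sub_cancel]
  simp only [map_sum, map_smul, tensorProj_cochainCoder, if_true]

theorem circ_apply {m n : ℕ} (f : Cochain k V m) (g : Cochain k V n) (v : ℕ → V) :
    circ k V m n f g (fun l => v l)
      = ∑ i ∈ Finset.range (m + 1), (-1 : k) ^ (n * i) • f fun l => insertSeq i g v l := by
  rw [← Fin.sum_univ_eq_sum_range (fun i => (-1 : k) ^ (n * i) • f fun l => insertSeq i g v l),
    circ, LinearMap.sum_apply, LinearMap.sum_apply, sum_apply]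
  refine Finset.sum_congr rfl fun i _ => ?_
  -- Counting places from `0` instead of `1` changes the Gerstenhaber exponent `n(i + 2)` into the
  -- Koszul exponent `n i`, which has the same parity.
  have hs : (-1 : k) ^ (n * ((i : ℕ) + 1 + 1)) = (-1 : k) ^ (n * (i : ℕ)) := by
    rw [show n * ((i : ℕ) + 1 + 1) = n * i + 2 * n by ring, pow_add, pow_mul _ 2]
    simp
  rw [hs]
  rfl

/-- The bracket is again a coderivation of degree `m + n`, so only its corestriction has to be
compared, and there each composite gives one of the two terms of the Gerstenhaber bracket. -/
theorem cochainCoder_gerstenhaber {m n : ℕ} (f : Cochain k V m) (g : Cochain k V n) :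
    (coderBracket k (tensorGrading k V) (tensorComul k (Desusp V)) m n (cochainToCoder k m f)
      (cochainToCoder k n g) : Module.End k _) = cochainCoder k (gerstenhaber k V m n f g) := by
  refine eq_cochainCoder k ?_ fun v => ?_
  · rw [Nat.cast_add]
    exact Subtype.property _
  · change tensorProj k _ (cochainCoder k f (cochainCoder k g _)
      - (-1 : k) ^ ((m : ℤ) * n) • cochainCoder k g (cochainCoder k f _)) = _
    rw [map_sub, map_smul, tensorProj_cochainCoder_comp k rfl,
      tensorProj_cochainCoder_comp k (add_comm m n), ← map_smul, ← map_sub, ← circ_apply,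
      ← circ_apply, ← Nat.cast_mul, zpow_natCast]
    rfl

theorem cochainCoderEquiv_bracket (a b : CochainSum k V) :
    cochainCoderEquiv k V (gerstenhaberSum k V a b)
      = tCoDerBracket k V (cochainCoderEquiv k V a) (cochainCoderEquiv k V b) := by
  induction a using DirectSum.induction_on with
  | zero => simp only [map_zero, LinearMap.zero_apply]
  | add x y hx hy => simp only [map_add, LinearMap.add_apply, hx, hy]
  | of m f =>
    induction b using DirectSum.induction_on with
    | zero => simp only [map_zero]
    | add x y hx hy => simp only [map_add, hx, hy]
    | of n g =>
      change cochainCoderEquiv k V (gerstenhaberSum k V (DirectSum.lof k ℕ _ m f)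
        (DirectSum.lof k ℕ _ n g)) = tCoDerBracket k V
          (cochainCoderEquiv k V (DirectSum.lof k ℕ _ m f))
          (cochainCoderEquiv k V (DirectSum.lof k ℕ _ n g))
      rw [cochainCoderEquiv_lof, cochainCoderEquiv_lof, coderSumBracket_lof, gerstenhaberSum,
        sumBilin_lof, cochainCoderEquiv_lof]
      exact lof_coder_congr k _ _ (Nat.cast_add m n) (cochainCoder_gerstenhaber k f g).symm

end Bracket

/-! ### The Hochschild differential as the bracket with the multiplication -/

section Differential

variable (k : Type u) [Field k] (A : Type v) [NonUnitalRing A] [Module k A]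
  [IsScalarTower k A A] [SMulCommClass k A A]

/-- The multiplication of `A` as a cochain. -/
def mulCochain : Cochain k A 1 :=
  -- With the identity as a cochain of degree `0`, left multiplication is `a₀ · id(a₁)`.
  leftMulCochain k (MultilinearMap.ofSubsingleton k A A (0 : Fin 1) LinearMap.id)

theorem mulCochain_apply (a : Fin 2 → A) : mulCochain k A a = a 0 * a 1 := rfl

variable {A}

/-- A coderivation of degree `1` is determined by its second corestriction; this gives the
uniqueness of `χ`. -/
theorem coe_eq_cochainCoder_mulCochain {χ : TCoDer k A 1} (hχ : CorrespondsToMul k A χ) :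
    (χ : Module.End k (TensorSum k (Desusp A))) = cochainCoder k (mulCochain k A) := by
  refine eq_cochainCoder k (n := 1) χ.2 fun v => ?_
  rw [mulCochain_apply, ← corestriction_tprod_down]
  refine Eq.trans ?_ (hχ (v 0) (v 1))
  congr 2
  funext j
  fin_cases j <;> rfl

/-- This is `δf = μ ∘ f - (-1)^n f ∘ μ`. The two insertions into `μ` give `f(a₀, …, aₙ) aₙ₊₁` and
`(-1)^n a₀ f(a₁, …, aₙ₊₁)`; inserting `μ` into `f` at place `i` multiplies neighbouring letters,
with sign `-(-1)^n (-1)^i = (-1)^(i + n + 1)`. -/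
theorem hochschild_apply_seq {n : ℕ} (f : Cochain k A n) (v : ℕ → A) :
    hochschild k A n f (fun l => v l)
      = ∑ i ∈ Finset.range (1 + 1), (-1 : k) ^ (n * i) •
          (mulCochain k A fun l => insertSeq i f v l)
        - (-1 : k) ^ n • ∑ i ∈ Finset.range (n + 1), (-1 : k) ^ (1 * i) •
          f fun l => insertSeq i (mulCochain k A) v l := by
  rw [hochschild_apply, Finset.sum_range_succ, Finset.sum_range_one, mulCochain_apply,
    mulCochain_apply, sub_eq_add_neg, Finset.smul_sum, ← Finset.sum_neg_distrib,
    ← Fin.sum_univ_eq_sum_range (fun i => -((-1 : k) ^ n • (-1 : k) ^ (1 * i) •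
      f fun l => insertSeq i (mulCochain k A) v l))]
  congr 1
  · rw [add_comm]
    congr 1
    · simp [insertSeq, add_comm]
    · simp [insertSeq, pow_add, add_comm]
  · refine Finset.sum_congr rfl fun i _ => ?_
    rw [smul_smul, ← neg_smul]
    congr 1
    · rw [one_mul]
      ring
    · congr 1
      funext j
      simp only [Fin.contractNth, insertSeq, mulCochain_apply, Fin.val_castSucc, Fin.val_succ]
      split_ifs with h1 h2
      · rfl
      · simp [h2]
      · rfl

theorem cochainCoder_hochschild {χ : TCoDer k A 1} (hχ : CorrespondsToMul k A χ) {n : ℕ}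
    (f : Cochain k A n) :
    (coderBracket k (tensorGrading k A) (tensorComul k (Desusp A)) 1 n χ
      (cochainToCoder k n f) : Module.End k _) = cochainCoder k (hochschild k A n f) := by
  refine eq_cochainCoder k ?_ fun v => ?_
  · rw [Nat.cast_add, add_comm, Nat.cast_one]
    exact Subtype.property _
  · rw [coe_coderBracket, coe_eq_cochainCoder_mulCochain k hχ, hochschild_apply_seq, one_mul,
      zpow_natCast, map_sub (down k), map_smul, ← tensorProj_cochainCoder_comp k (add_comm n 1),
      ← tensorProj_cochainCoder_comp k rfl]
    change tensorProj k _ (cochainCoder k (mulCochain k A) (cochainCoder k f _)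
      - (-1 : k) ^ n • cochainCoder k f (cochainCoder k (mulCochain k A) _)) = _
    rw [map_sub, map_smul]

theorem cochainCoderEquiv_hochschild {χ : TCoDer k A 1} (hχ : CorrespondsToMul k A χ)
    (a : CochainSum k A) :
    cochainCoderEquiv k A (hochschildSum k A a)
      = tCoDerDifferential k χ (cochainCoderEquiv k A a) := by
  induction a using DirectSum.induction_on with
  | zero => simp only [map_zero]
  | add x y hx hy => simp only [map_add, hx, hy]
  | of n f =>
    change cochainCoderEquiv k A (hochschildSum k A (DirectSum.lof k ℕ _ n f))
      = tCoDerDifferential k χ (cochainCoderEquiv k A (DirectSum.lof k ℕ _ n f))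
    rw [cochainCoderEquiv_lof, tCoDerDifferential, coderDifferential, coderSumBracket_lof,
      hochschildSum, DirectSum.toModule_lof, LinearMap.comp_apply, cochainCoderEquiv_lof]
    exact lof_coder_congr k _ _ (by push_cast; ring) (cochainCoder_hochschild k hχ f).symm

theorem isDGLieIso_cochainCoderEquiv {χ : TCoDer k A 1} (hχ : CorrespondsToMul k A χ) :
    IsDGLieIso (L := CochainSum k A) (L' := TCoDerSum k A) (cochainGrading k A)
      (gerstenhaberSum k A) (hochschildSum k A) (tCoDerGrading k A) (tCoDerBracket k A)
      (tCoDerDifferential k χ) (cochainCoderEquiv k A) where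
  map_grading := cochainCoderEquiv_mem_iff k
  map_br := cochainCoderEquiv_bracket k
  map_d := cochainCoderEquiv_hochschild k hχ

/-! ### The quadratic differential of an associative multiplication -/

variable (A)

theorem cochainCoder_mulCochain_mem : cochainCoder k (mulCochain k A) ∈ TCoDer k A 1 :=
  cochainCoder_mem k (mulCochain k A)

/-- The coderivation of an associative multiplication squares to zero. -/
theorem cochainCoder_mulCochain_sq [CharZero k] :
    cochainCoder k (mulCochain k A) ∘ₗ cochainCoder k (mulCochain k A) = 0 := by
  -- The commutator `[χ, χ]` is a coderivation of degree `2`, so it suffices to compute its third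
  -- corestriction. That of `χ²` is `(ab)c - a(bc) = 0`.
  have hmem := commutator_mem_CoDer k _ _ 1 1 _ _ (cochainCoder_mulCochain_mem k A)
    (cochainCoder_mulCochain_mem k A)
  have h0 := eq_cochainCoder k (n := 2) (φ := 0) hmem fun v => by
    simp only [LinearMap.sub_apply, LinearMap.smul_apply, LinearMap.comp_apply, map_sub, map_smul]
    rw [tensorProj_cochainCoder_comp k (m := 1) (n := 1) rfl]
    simp [Finset.sum_range_succ, mulCochain_apply, insertSeq, mul_assoc]
  have hz := map_zero (cochainToCoder k (V := A) 2)
  have h1 : cochainCoder k (0 : Cochain k A 2) = 0 := congrArg Subtype.val hz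
  rw [h1, one_mul, zpow_one] at h0
  refine LinearMap.ext fun x => ?_
  have hx := LinearMap.congr_fun h0 x
  -- As `χ` is odd, `[χ, χ] = 2χ²`; characteristic zero allows division by `2`.
  rw [LinearMap.sub_apply, LinearMap.smul_apply, neg_one_smul, sub_neg_eq_add, ← two_smul k] at hx
  exact (smul_eq_zero.1 hx).resolve_left two_ne_zero

theorem existsUnique_quadraticDifferential [CharZero k] :
    ∃! χ : TCoDer k A 1, IsQuadraticDifferential k A χ ∧ CorrespondsToMul k A χ := by
  refine ⟨⟨_, cochainCoder_mulCochain_mem k A⟩,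
    ⟨⟨cochainCoder_mulCochain_sq k A, fun n hn =>
      corestriction_cochainCoder_of_ne k _ (by omega)⟩, fun a b => ?_⟩,
    fun χ hχ => Subtype.ext (coe_eq_cochainCoder_mulCochain k hχ.2)⟩
  have := corestriction_cochainCoder k (mulCochain k A) ![a, b]
  rw [mulCochain_apply] at this
  refine Eq.trans ?_ this
  congr 2

end Differential

/-! ### Naturality -/

section Naturality

variable (k : Type u) [Field k] {A B : Type v} [NonUnitalRing A] [Module k A]
  [NonUnitalRing B] [Module k B]

theorem tensorMapDesusp_seqWord (h : A →ₙₐ[k] B) (v : ℕ → A) (N : ℕ) :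
    tensorMapDesusp k h (seqWord k v N) = seqWord k (fun j => h (v j)) N := by
  rw [tensorMapDesusp, tensorMap, seqWord, tensorIncl, DirectSum.lmap_lof,
    PiTensorProduct.map_tprod]
  rfl

/-- The two sides agree insertion by insertion: applying `h` to each letter turns the word with `φ`
inserted at `i` into the image word with `ψ` inserted at `i`. -/
theorem tensorMapDesusp_comp_cochainCoder (h : A →ₙₐ[k] B) {n : ℕ} (φ : Cochain k A n)
    (ψ : Cochain k B n) (hφψ : ∀ a : Fin (n + 1) → A, h (φ a) = ψ fun i => h (a i)) :
    tensorMapDesusp k h ∘ₗ cochainCoder k φ = cochainCoder k ψ ∘ₗ tensorMapDesusp k h := by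
  refine linearMap_ext_seqWord k fun v N => ?_
  simp only [LinearMap.comp_apply, tensorMapDesusp_seqWord, cochainCoder_seqWord, map_sum,
    map_smul]
  refine Finset.sum_congr rfl fun i _ => ?_
  congr 2
  funext j
  unfold insertSeq
  split_ifs
  · rfl
  · exact hφψ _
  · rfl

end Naturality

end

/-! ### The theorem -/

theorem mainTheorem3 (k : Type u) [Field k] [CharZero k] :
    -- the quadratic differential `χ` corresponding to the multiplication exists and is unique
    (∀ (A : Type v) [NonUnitalRing A] [Module k A] [IsScalarTower k A A] [SMulCommClass k A A],
      ∃! χ : TCoDer k A 1, IsQuadraticDifferential k A χ ∧ CorrespondsToMul k A χ) ∧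
    ∃ ξ : ∀ (A : Type v) [NonUnitalRing A] [Module k A] [IsScalarTower k A A]
        [SMulCommClass k A A], CochainSum k A ≃ₗ[k] TCoDerSum k A,
      -- `ξ A` is an isomorphism of dg-Lie algebras
      (∀ (A : Type v) [NonUnitalRing A] [Module k A] [IsScalarTower k A A] [SMulCommClass k A A]
        (χ : TCoDer k A 1), IsQuadraticDifferential k A χ → CorrespondsToMul k A χ →
        IsDGLie (cochainGrading k A) (gerstenhaberSum k A) (hochschildSum k A) ∧
        IsDGLie (L := TCoDerSum k A) (tCoDerGrading k A) (tCoDerBracket k A) (tCoDerDifferential k χ) ∧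
        IsDGLieIso (L := CochainSum k A) (L' := TCoDerSum k A) (cochainGrading k A) (gerstenhaberSum k A) (hochschildSum k A)
          (tCoDerGrading k A) (tCoDerBracket k A) (tCoDerDifferential k χ) (ξ A)) ∧
      -- `ξ A` sends a cochain to the coderivation with the corresponding corestriction
      (∀ (A : Type v) [NonUnitalRing A] [Module k A] [IsScalarTower k A A] [SMulCommClass k A A]
        (n : ℕ) (φ : Cochain k A n), ∃ θ : TCoDer k A n, IsCoderivationOf k φ θ ∧
          ξ A (DirectSum.lof k ℕ (fun n => Cochain k A n) n φ)
            = DirectSum.lof k ℤ (fun d => TCoDer k A d) n θ) ∧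
      -- `ξ` is natural: it sends cochains related by an algebra homomorphism to coderivations
      -- related by the induced map of tensor coalgebras
      (∀ (A : Type v) [NonUnitalRing A] [Module k A] [IsScalarTower k A A] [SMulCommClass k A A]
        (B : Type v) [NonUnitalRing B] [Module k B] [IsScalarTower k B B] [SMulCommClass k B B]
        (h : A →ₙₐ[k] B) (n : ℕ) (φ : Cochain k A n) (ψ : Cochain k B n),
        (∀ a : Fin (n + 1) → A, h (φ a) = ψ fun i => h (a i)) →
        tensorMapDesusp k h ∘ₗ
            (ξ A (DirectSum.lof k ℕ (fun n => Cochain k A n) n φ) n :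
              Module.End k (TensorSum k (Desusp A)))
          = (ξ B (DirectSum.lof k ℕ (fun n => Cochain k B n) n ψ) n :
              Module.End k (TensorSum k (Desusp B))) ∘ₗ tensorMapDesusp k h) := by
  refine ⟨fun A => existsUnique_quadraticDifferential k A, fun A => cochainCoderEquiv k A,
    ?_, ?_, ?_⟩
  · intro A _ _ _ _ χ hχ hμ
    have hiso := isDGLieIso_cochainCoderEquiv k hμ
    have hlie := isDGLie_coder k _ _ χ hχ.1
    -- The dg-Lie axioms of the Hochschild side are inherited from the coderivations through `ξ`;
    -- only the decomposition into degrees is supplied directly.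
    exact ⟨hiso.isDGLie hlie (DirectSum.Decomposition.isInternal _), hlie, hiso⟩
  · intro A _ _ _ _ n φ
    exact ⟨cochainToCoder k n φ, isCoderivationOf_cochainToCoder k φ, cochainCoderEquiv_lof k A n φ⟩
  · intro A _ _ _ _ B _ _ _ _ h n φ ψ hφψ
    rw [coe_cochainCoderEquiv_lof, coe_cochainCoderEquiv_lof]
    exact tensorMapDesusp_comp_cochainCoder k h φ ψ hφψ
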